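/- Let $p$ be a prime and let $G$ be a Tarski monster group of order $p$, i.e. an infinite, finitely generated group in which every nontrivial proper subgroup is cyclic of order $p$. Assume that $G$ is non-amenable, i.e. that there is no positive unital linear functional on $\ell^\infty(G)$ which is invariant under left translation. A $G$-boundary is a non-empty compact Hausdorff space $X$ on which the discrete group $G$ acts by homeomorphisms such that every orbit is dense (minimality) and, for every regular Borel probability measure $\nu$ on $X$, the weak* closure of the orbit $G\nu$ contains a point mass $\delta_x$, $x\in X$ (strong proximality). The Furstenberg boundary $\partial_F G$ is the universal $G$-boundary, i.e. the $G$-boundary (unique up to $G$-equivariant homeomorphism) of which every $G$-boundary is a continuous $G$-equivariant image. Then: 1. The Furstenberg boundary $\partial_F G$ exists, and the action of $G$ on it is topologically free: for every $s\in G\setminus\{e\}$ the set $\{x\in\partial_F G \mid sx\neq x\}$ is dense in $\partial_F G$. 2. $G$ is C*-simple: the reduced C*-algebra $\mathrm{C}^*_r(G)$, i.e. the norm closed *-subalgebra of $B(\ell^2(G))$ generated by the operators $\lambda_s$, $s\in G$, $(\lambda_s\xi)(t)=\xi(s^{-1}t)$, has no closed two-sided ideals other than $\{0\}$ and $\mathrm{C}^*_r(G)$.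 -/

import Mathlib

open scoped ENNReal ComplexOrder

universe u

namespace Tarski

/-! ### Compact `G`-spaces, boundaries and the Furstenberg boundary

A compact `G`-space for a discrete group `G` is a compact Hausdorff space with an action of `G`
by homeomorphisms, i.e. with `MulAction G X` and `ContinuousConstSMul G X`. -/

section Boundary

variable (G : Type u) [Group G]
variable (X : Type u) [TopologicalSpace X] [MulAction G X]

/-- The action is topologically free: every `s ≠ 1` moves a dense set of points. -/
def IsTopologicallyFree : Prop :=
  ∀ s : G, s ≠ 1 → Dense {x : X | s • x ≠ x}

/-- The action is strongly proximal: for every regular Borel probability measure `ν` on `X`, the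
weak-* closure of the orbit `G ν` contains a point mass. -/
def IsStronglyProximal [ContinuousConstSMul G X] : Prop :=
  letI : MeasurableSpace X := borel X
  haveI : BorelSpace X := ⟨rfl⟩
  ∀ ν : MeasureTheory.ProbabilityMeasure X, (ν : MeasureTheory.Measure X).Regular →
    ∃ x : X, MeasureTheory.diracProba x ∈
      closure (Set.range fun s : G =>
        ν.map (f := fun y : X => s • y) (continuous_const_smul s).measurable.aemeasurable)

/-- A `G`-boundary: a nonempty compact Hausdorff `G`-space on which the action is minimal (every
orbit is dense) and strongly proximal. -/
structure IsBoundary [ContinuousConstSMul G X] : Prop where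
  compact : CompactSpace X
  hausdorff : T2Space X
  nonempty : Nonempty X
  minimal : MulAction.IsMinimal G X
  stronglyProximal : IsStronglyProximal G X

/-- `X` is a Furstenberg boundary of `G`, i.e. a universal `G`-boundary: it is a `G`-boundary and
every `G`-boundary is a continuous `G`-equivariant image of it. It is enough to let `Y` range over
the universe of `G`: a `G`-boundary is a continuous image of the Stone-Čech compactification of the
discrete space `G`, hence is homeomorphic to a space in that universe. -/
structure IsFurstenbergBoundary [ContinuousConstSMul G X] : Prop where
  isBoundary : IsBoundary G X
  universal : ∀ (Y : Type u) [TopologicalSpace Y] [MulAction G Y] [ContinuousConstSMul G Y],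
    IsBoundary G Y → ∃ f : X → Y, Continuous f ∧ Function.Surjective f ∧
      ∀ (s : G) (x : X), f (s • x) = s • f x

end Boundary

/-! ### Amenability and Tarski monsters -/

section Groups

variable (G : Type u) [Group G]

/-- `G` is amenable: there is a positive unital linear functional `m` on `ℓ^∞(G)` that is invariant
under the left translations `(s f)(t) = f (s⁻¹ t)`. -/
def IsAmenable : Prop :=
  ∃ m : lp (fun _ : G => ℂ) ∞ →ₗ[ℂ] ℂ,
    m 1 = 1 ∧
    (∀ f : lp (fun _ : G => ℂ) ∞, (∀ t, 0 ≤ f t) → 0 ≤ m f) ∧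
    ∀ (s : G) (f g : lp (fun _ : G => ℂ) ∞), (∀ t, g t = f (s⁻¹ * t)) → m g = m f

/-- `G` is a Tarski monster of order `p`: `p` is prime and `G` is an infinite finitely generated
group all of whose nontrivial proper subgroups are cyclic of order `p`. -/
structure IsTarskiMonster (p : ℕ) : Prop where
  prime : p.Prime
  infinite : Infinite G
  fg : Group.FG G
  cyclic : ∀ H : Subgroup G, H ≠ ⊥ → H ≠ ⊤ → IsCyclic H ∧ Nat.card H = p

end Groups

/-! ### The reduced C*-algebra -/

section Reduced

variable (G : Type u) [Group G]

/-- The Hilbert space `ℓ²(G)`. -/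
abbrev ell2 : Type u := lp (fun _ : G => ℂ) 2

variable {G}

theorem memlp_translate (s : G) (ξ : ell2 G) :
    Memℓp (fun t : G => ξ (s⁻¹ * t)) 2 := by
  have h := (memℓp_gen_iff (p := 2) (by norm_num)).1 (lp.memℓp ξ)
  exact (memℓp_gen_iff (p := 2) (by norm_num)).2
    ((Equiv.mulLeft s⁻¹).summable_iff.2 h)

/-- The left regular representation as isometries: `(λ_s ξ)(t) = ξ (s⁻¹ t)`. -/
noncomputable def leftRegularIsometry (s : G) : ell2 G →ₗᵢ[ℂ] ell2 G where
  toFun ξ := ⟨fun t => ξ (s⁻¹ * t), memlp_translate s ξ⟩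
  map_add' _ _ := rfl
  map_smul' _ _ := rfl
  norm_map' ξ := by
    rw [lp.norm_eq_tsum_rpow (by norm_num), lp.norm_eq_tsum_rpow (by norm_num)]
    congr 1
    exact (Equiv.mulLeft s⁻¹).tsum_eq fun t => ‖ξ t‖ ^ (2 : ℝ≥0∞).toReal

/-- The unitary operators `λ_s` of the left regular representation, as elements of `B(ℓ²(G))`. -/
noncomputable def leftRegular (s : G) : ell2 G →L[ℂ] ell2 G :=
  (leftRegularIsometry s).toContinuousLinearMap

variable (G)

/-- The reduced C*-algebra of `G`: the C*-subalgebra of `B(ℓ²(G))` generated by the operators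
`λ_s`, i.e. the norm closure of the *-algebra that they generate. -/
noncomputable def reducedCStarAlgebra : StarSubalgebra ℂ (ell2 G →L[ℂ] ell2 G) :=
  (StarAlgebra.adjoin ℂ (Set.range (leftRegular (G := G)))).topologicalClosure

/-- `G` is C*-simple: the only closed two-sided ideals of its reduced C*-algebra are zero and the
whole algebra (which is unital and nonzero). -/
def IsCStarSimple : Prop :=
  ∀ I : TwoSidedIdeal (reducedCStarAlgebra G),
    IsClosed (I : Set (reducedCStarAlgebra G)) → I = ⊥ ∨ I = ⊤

end Reduced

end Tarski

/-!
A minimal compact convex `G`-invariant set `K` of states on `ℓ^∞(G)` has the closure of its extreme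
points as a Furstenberg boundary. By Milman's theorem the orbit of each point of `K` accumulates at
all extreme points, which gives minimality, and together with Bauer's characterization of extreme
points by their representing measures it gives strong proximality. Pushing states on `G` forward
along an orbit map into another boundary `Y` carries the extreme points of `K` to point masses,
hence maps the boundary onto `Y`.

A fixed point in the Furstenberg boundary maps to a fixed state, an invariant mean. If `G` is a
non-amenable Tarski monster and `s ≠ 1` fixes a nonempty open set `U` pointwise, then the stabilizer
of each point of `U` is thus a proper subgroup, hence equal to `⟨s⟩`. By compactness every conjugate
of `s` lies in one of finitely many conjugates of the finite group `⟨s⟩`. But the conjugacy class of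
`s` is infinite, as its centralizer is a proper, hence finite, subgroup.

By Baire's theorem some point `y` of the Furstenberg boundary `X` has trivial stabilizer. Given a
proper ideal of the reduced C*-algebra, take a state of `B(ℓ²(G))` vanishing on it, and let `C(X)`
act on `ℓ²(G)` by multiplication along an orbit. Strong proximality allows us to choose the state
such that it restricts to the evaluation at `y` on `C(X)`. Then it is multiplicative along `C(X)`,
so it vanishes on all `λ_s` with `s ≠ 1`. Hence it coincides with the canonical trace on the reduced
C*-algebra; the trace is faithful, so the ideal is zero.
-/

namespace Tarski

open Set Filter Topology MeasureTheory
open scoped BoundedContinuousFunction Pointwise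

/-! ### Milman's theorem -/

section Milman

variable {E : Type*} [AddCommGroup E] [Module ℝ E] [TopologicalSpace E] [IsTopologicalAddGroup E]
  [ContinuousSMul ℝ E]

theorem isCompact_convexJoin {s t : Set E} (hs : IsCompact s) (ht : IsCompact t) :
    IsCompact (convexJoin ℝ s t) := by
  have himage : convexJoin ℝ s t =
      (fun p : (E × E) × ℝ => (1 - p.2) • p.1.1 + p.2 • p.1.2) '' ((s ×ˢ t) ×ˢ Icc 0 1) := by
    ext x
    simp [mem_convexJoin, segment_eq_image, and_assoc]
  rw [himage]
  exact ((hs.prod ht).prod isCompact_Icc).image (by fun_prop)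

theorem isCompact_convexHull_union {s t : Set E} (hs : IsCompact s) (ht : IsCompact t)
    (hsc : Convex ℝ s) (htc : Convex ℝ t) : IsCompact (convexHull ℝ (s ∪ t)) := by
  rcases s.eq_empty_or_nonempty with rfl | hs0
  · simpa [htc.convexHull_eq] using ht
  rcases t.eq_empty_or_nonempty with rfl | ht0
  · simpa [hsc.convexHull_eq] using hs
  · rw [hsc.convexHull_union htc hs0 ht0]
    exact isCompact_convexJoin hs ht

theorem isCompact_convexHull_biUnion {ι : Type*} (t : Finset ι) {K : ι → Set E}
    (hK : ∀ i ∈ t, IsCompact (K i)) (hKc : ∀ i ∈ t, Convex ℝ (K i)) :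
    IsCompact (convexHull ℝ (⋃ i ∈ t, K i)) := by
  classical
  induction t using Finset.induction_on with
  | empty => simp
  | insert i t _ ih =>
    rw [Finset.set_biUnion_insert, ← convexHull_convexHull_union_right]
    exact isCompact_convexHull_union (hK i (t.mem_insert_self i))
      (ih (fun j hj => hK j (Finset.mem_insert_of_mem hj))
        fun j hj => hKc j (Finset.mem_insert_of_mem hj))
      (hKc i (t.mem_insert_self i)) (convex_convexHull ℝ _)

variable [LocallyConvexSpace ℝ E] [T2Space E]

theorem extremePoints_closedConvexHull_subset {B : Set E} (hB : IsCompact B)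
    (hhull : IsCompact (closedConvexHull ℝ B)) :
    (closedConvexHull ℝ B).extremePoints ℝ ⊆ B := by
  intro e he
  by_contra heB
  let H := closedConvexHull ℝ B
  have hseparate : ∀ b ∈ B, ∃ C ∈ 𝓝 b, IsClosed C ∧ Convex ℝ C ∧ e ∉ C := fun b hb => by
    obtain ⟨l, hl⟩ := geometric_hahn_banach_point_point (ne_of_mem_of_not_mem hb heB)
    obtain ⟨r, hbr, hre⟩ := exists_between hl
    exact ⟨{x | l x ≤ r}, mem_of_superset ((isOpen_Iio.preimage l.continuous).mem_nhds hbr)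
      fun x (hx : l x < r) => hx.le, isClosed_le l.continuous continuous_const,
      convex_halfSpace_le l.isLinear r, hre.not_ge⟩
  choose! C hC hCclosed hCconvex heC using hseparate
  obtain ⟨t, htB, hBt⟩ := hB.elim_nhds_subcover C hC
  have hcompact : IsCompact (convexHull ℝ (⋃ b ∈ t, H ∩ C b)) :=
    isCompact_convexHull_biUnion t (fun b hb => hhull.inter_right (hCclosed b (htB b hb)))
      fun b hb => convex_closedConvexHull.inter (hCconvex b (htB b hb))
  have hHeq : H = convexHull ℝ (⋃ b ∈ t, H ∩ C b) := by
    refine subset_antisymm (closedConvexHull_min (fun x hx => ?_) (convex_convexHull ℝ _)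
      hcompact.isClosed) (convexHull_min (iUnion₂_subset fun b _ => inter_subset_left)
        convex_closedConvexHull)
    obtain ⟨b, hbt, hxb⟩ := mem_iUnion₂.1 (hBt hx)
    exact subset_convexHull ℝ _ (mem_iUnion₂.2 ⟨b, hbt, subset_closedConvexHull hx, hxb⟩)
  rw [show closedConvexHull ℝ B = H from rfl, hHeq] at he
  obtain ⟨b, hbt, -, heb⟩ := mem_iUnion₂.1 (extremePoints_convexHull_subset he)
  exact heC b (htB b hbt) heb

end Milman

/-! ### States and their barycenters -/

noncomputable section States

section WeakDual

variable {A : Type*} [NormedAddCommGroup A] [NormedSpace ℝ A]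

instance : LocallyConvexSpace ℝ (WeakDual ℝ A) :=
  inferInstanceAs (LocallyConvexSpace ℝ (WeakBilin (topDualPairing ℝ A)))

theorem exists_forall_eq_apply (l : WeakDual ℝ A →L[ℝ] ℝ) :
    ∃ a : A, ∀ φ : WeakDual ℝ A, l φ = φ a := by
  obtain ⟨a, ha⟩ := LinearMap.dualEmbedding_surjective (topDualPairing ℝ A) l
  exact ⟨a, fun φ => (DFunLike.congr_fun ha φ).symm⟩

end WeakDual

variable {Z Y : Type*} [TopologicalSpace Z] [TopologicalSpace Y]

/-- The continuous linear functionals on the bounded continuous functions on `Z`, with the weak-*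
topology. This is a type synonym, so that it can carry the action induced by an action on `Z`. -/
def Functional (Z : Type*) [TopologicalSpace Z] : Type _ := WeakDual ℝ (Z →ᵇ ℝ)

instance : AddCommGroup (Functional Z) :=
  inferInstanceAs (AddCommGroup (WeakDual ℝ (Z →ᵇ ℝ)))

instance : Module ℝ (Functional Z) :=
  inferInstanceAs (Module ℝ (WeakDual ℝ (Z →ᵇ ℝ)))

instance : TopologicalSpace (Functional Z) :=
  inferInstanceAs (TopologicalSpace (WeakDual ℝ (Z →ᵇ ℝ)))

instance : IsTopologicalAddGroup (Functional Z) :=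
  inferInstanceAs (IsTopologicalAddGroup (WeakDual ℝ (Z →ᵇ ℝ)))

instance : ContinuousSMul ℝ (Functional Z) :=
  inferInstanceAs (ContinuousSMul ℝ (WeakDual ℝ (Z →ᵇ ℝ)))

instance : T2Space (Functional Z) :=
  inferInstanceAs (T2Space (WeakDual ℝ (Z →ᵇ ℝ)))

instance : LocallyConvexSpace ℝ (Functional Z) :=
  inferInstanceAs (LocallyConvexSpace ℝ (WeakDual ℝ (Z →ᵇ ℝ)))

instance : FunLike (Functional Z) (Z →ᵇ ℝ) ℝ :=
  inferInstanceAs (FunLike (WeakDual ℝ (Z →ᵇ ℝ)) (Z →ᵇ ℝ) ℝ)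

instance : LinearMapClass (Functional Z) ℝ (Z →ᵇ ℝ) ℝ :=
  inferInstanceAs (LinearMapClass (WeakDual ℝ (Z →ᵇ ℝ)) ℝ (Z →ᵇ ℝ) ℝ)

namespace Functional

@[ext]
theorem ext {φ ψ : Functional Z} (h : ∀ f, φ f = ψ f) : φ = ψ := DFunLike.ext φ ψ h

@[simp]
theorem add_apply (φ ψ : Functional Z) (f : Z →ᵇ ℝ) : (φ + ψ) f = φ f + ψ f := rfl

@[simp]
theorem smul_apply (c : ℝ) (φ : Functional Z) (f : Z →ᵇ ℝ) : (c • φ) f = c * φ f := rfl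

theorem continuous_eval (f : Z →ᵇ ℝ) : Continuous fun φ : Functional Z => φ f :=
  WeakDual.eval_continuous f

theorem continuous_of_eval {X : Type*} [TopologicalSpace X] {Φ : X → Functional Z}
    (h : ∀ f, Continuous fun x => Φ x f) : Continuous Φ :=
  WeakDual.continuous_of_continuous_eval h

theorem exists_eq_eval (l : Functional Z →L[ℝ] ℝ) :
    ∃ f : Z →ᵇ ℝ, ∀ φ : Functional Z, l φ = φ f :=
  exists_forall_eq_apply (A := Z →ᵇ ℝ) l

/-- The push-forward of functionals along a continuous map. -/
def map (h : C(Z, Y)) : Functional Z →L[ℝ] Functional Y where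
  toFun φ := StrongDual.toWeakDual
    ((WeakDual.toStrongDual φ).comp (BoundedContinuousFunction.compContinuousCLM ℝ ℝ h))
  map_add' _ _ := rfl
  map_smul' _ _ := rfl
  cont := continuous_of_eval fun f => continuous_eval (f.compContinuous h)

end Functional

variable (Z) in
/-- The states on the bounded continuous functions: positive functionals of value one at one. -/
def stateSpace : Set (Functional Z) :=
  {φ | φ 1 = 1 ∧ ∀ f : Z →ᵇ ℝ, 0 ≤ f → 0 ≤ φ f}

variable {φ : Functional Z}

theorem apply_mono_of_mem_stateSpace (hφ : φ ∈ stateSpace Z) : Monotone φ := fun f g hfg => by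
  have := hφ.2 (g - f) (sub_nonneg.2 hfg)
  rwa [map_sub, sub_nonneg] at this

theorem apply_smul_one_of_mem_stateSpace (hφ : φ ∈ stateSpace Z) (c : ℝ) : φ (c • 1) = c := by
  rw [map_smul, hφ.1, smul_eq_mul, mul_one]

theorem abs_apply_le_apply_abs_of_mem_stateSpace (hφ : φ ∈ stateSpace Z) (f : Z →ᵇ ℝ) :
    |φ f| ≤ φ |f| :=
  abs_le'.2 ⟨apply_mono_of_mem_stateSpace hφ (le_abs_self f),
    (map_neg φ f).symm.trans_le (apply_mono_of_mem_stateSpace hφ (neg_le_abs f))⟩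

theorem abs_apply_le_norm_of_mem_stateSpace (hφ : φ ∈ stateSpace Z) (f : Z →ᵇ ℝ) :
    |φ f| ≤ ‖f‖ := by
  refine (abs_apply_le_apply_abs_of_mem_stateSpace hφ f).trans ?_
  rw [← apply_smul_one_of_mem_stateSpace hφ ‖f‖]
  exact apply_mono_of_mem_stateSpace hφ fun z => by simpa using f.norm_coe_le_norm z

variable (Z) in
theorem isClosed_stateSpace : IsClosed (stateSpace Z) := by
  simp only [stateSpace, ofPred_and, ofPred_forall]
  exact (isClosed_eq (Functional.continuous_eval 1) continuous_const).inter <|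
    isClosed_iInter fun f => isClosed_iInter fun _ =>
      isClosed_le continuous_const (Functional.continuous_eval f)

variable (Z) in
theorem isCompact_stateSpace : IsCompact (stateSpace Z) := by
  refine (WeakDual.isCompact_closedBall (0 : StrongDual ℝ (Z →ᵇ ℝ)) 1).of_isClosed_subset
    (isClosed_stateSpace Z) fun φ hφ => ?_
  rw [mem_preimage, mem_closedBall_zero_iff]
  refine ContinuousLinearMap.opNorm_le_bound _ zero_le_one fun f => ?_
  rw [one_mul]
  exact abs_apply_le_norm_of_mem_stateSpace hφ f

variable (Z) in
theorem convex_stateSpace : Convex ℝ (stateSpace Z) := by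
  refine fun φ hφ ψ hψ a b ha hb hab => ⟨?_, fun f hf => ?_⟩
  · simp [hφ.1, hψ.1, hab]
  · exact add_nonneg (mul_nonneg ha (hφ.2 f hf)) (mul_nonneg hb (hψ.2 f hf))

theorem map_mem_stateSpace (h : C(Z, Y)) (hφ : φ ∈ stateSpace Z) :
    Functional.map h φ ∈ stateSpace Y :=
  ⟨hφ.1, fun f hf => hφ.2 (f.compContinuous h) fun z => hf (h z)⟩

/-- The evaluation of functions at the point `z`, i.e. the state given by the point mass at `z`. -/
def pointState (z : Z) : Functional Z :=
  StrongDual.toWeakDual (BoundedContinuousFunction.evalCLM ℝ z)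

@[simp]
theorem pointState_apply (z : Z) (f : Z →ᵇ ℝ) : pointState z f = f z := rfl

theorem pointState_mem_stateSpace (z : Z) : pointState z ∈ stateSpace Z :=
  ⟨rfl, fun _ hf => hf z⟩

theorem continuous_pointState : Continuous (pointState : Z → Functional Z) :=
  Functional.continuous_of_eval fun f => f.continuous

theorem pointState_injective [T35Space Z] :
    Function.Injective (pointState : Z → Functional Z) := by
  intro x y hxy
  by_contra hne
  obtain ⟨f, hf, hfne⟩ := separatesPoints_continuous_of_t35Space_Icc hne
  let g : Z →ᵇ ℝ := BoundedContinuousFunction.ofNormedAddCommGroup (fun z => (f z : ℝ))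
    (continuous_subtype_val.comp hf) 1
    fun z => by simpa only [Real.norm_of_nonneg (f z).2.1] using (f z).2.2
  exact hfne (Subtype.ext (DFunLike.congr_fun hxy g))

variable (Z) in
theorem closedConvexHull_range_pointState :
    closedConvexHull ℝ (range (pointState : Z → Functional Z)) = stateSpace Z := by
  refine subset_antisymm (closedConvexHull_min (range_subset_iff.2 pointState_mem_stateSpace)
    (convex_stateSpace Z) (isClosed_stateSpace Z)) fun φ hφ => ?_
  by_contra hφhull
  obtain ⟨l, r, hlr, hrl⟩ := geometric_hahn_banach_closed_point convex_closedConvexHull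
    isClosed_closedConvexHull hφhull
  obtain ⟨f, hf⟩ := Functional.exists_eq_eval l
  simp only [hf] at hlr hrl
  refine hrl.not_ge ?_
  rw [← apply_smul_one_of_mem_stateSpace hφ r]
  refine apply_mono_of_mem_stateSpace hφ fun z => ?_
  simpa using (hlr _ (subset_closedConvexHull ⟨z, rfl⟩)).le

theorem extremePoints_stateSpace_subset [CompactSpace Z] :
    (stateSpace Z).extremePoints ℝ ⊆ range pointState := by
  rw [← closedConvexHull_range_pointState]
  refine extremePoints_closedConvexHull_subset (isCompact_range continuous_pointState) ?_
  rw [closedConvexHull_range_pointState]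
  exact isCompact_stateSpace Z

theorem eq_pointState_of_le {c : ℝ} {z : Z} (hφ : φ ∈ stateSpace Z)
    (h : ∀ f : Z →ᵇ ℝ, 0 ≤ f → φ f ≤ c * f z) : φ = pointState z := by
  ext f
  have hnull : φ |f - f z • 1| ≤ 0 := (h _ (abs_nonneg _)).trans_eq (by simp)
  have := abs_nonpos_iff.1 ((abs_apply_le_apply_abs_of_mem_stateSpace hφ _).trans hnull)
  rwa [map_sub, apply_smul_one_of_mem_stateSpace hφ, sub_eq_zero] at this

theorem pointState_mem_extremePoints (z : Z) : pointState z ∈ (stateSpace Z).extremePoints ℝ := by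
  refine mem_extremePoints_iff_left.2 ⟨pointState_mem_stateSpace z, fun φ hφ ψ hψ hz => ?_⟩
  obtain ⟨a, b, ha, hb, -, hab⟩ := hz
  refine eq_pointState_of_le (c := a⁻¹) hφ fun f hf => ?_
  have hsum : a * φ f + b * ψ f = f z := DFunLike.congr_fun hab f
  rw [le_inv_mul_iff₀ ha]
  linarith [mul_nonneg hb.le (hψ.2 f hf)]

end States

section Barycenter

variable {X E : Type*} [TopologicalSpace X] [CompactSpace X] [AddCommGroup E] [Module ℝ E]
  [TopologicalSpace E] {ι : C(X, E)} {K : Set E} {μ : Functional X} {x y e : E}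

/-- `x` is the barycenter of the functional `μ` on `X`, where `X` is mapped to the vector space `E`
by `ι`: if `μ` is the integral against a measure on `X`, then `x` is the weak integral of `ι`. -/
def IsBarycenter (ι : C(X, E)) (μ : Functional X) (x : E) : Prop :=
  ∀ l : E →L[ℝ] ℝ, μ (BoundedContinuousFunction.mkOfCompact ((l : C(E, ℝ)).comp ι)) = l x

theorem isBarycenter_pointState (ι : C(X, E)) (z : X) : IsBarycenter ι (pointState z) (ι z) :=
  fun _ => rfl

theorem IsBarycenter.convexCombination {ν : Functional X} (hμ : IsBarycenter ι μ x)
    (hν : IsBarycenter ι ν y) (a b : ℝ) : IsBarycenter ι (a • μ + b • ν) (a • x + b • y) :=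
  fun l => by simp [hμ l, hν l]

theorem isClosed_isBarycenter (ι : C(X, E)) :
    IsClosed {p : Functional X × E | IsBarycenter ι p.1 p.2} := by
  simp only [IsBarycenter, ofPred_forall]
  exact isClosed_iInter fun l =>
    isClosed_eq ((Functional.continuous_eval _).comp continuous_fst)
      (l.continuous.comp continuous_snd)

theorem exists_isBarycenter (hK : IsCompact K) (hKc : Convex ℝ K) (hι : ∀ z, ι z ∈ K)
    (hμ : μ ∈ stateSpace X) : ∃ x ∈ K, IsBarycenter ι μ x := by
  let S : Set (Functional X) :=
    Prod.fst '' ((stateSpace X ×ˢ K) ∩ {p | IsBarycenter ι p.1 p.2})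
  have hSclosed : IsClosed S := ((((isCompact_stateSpace X).prod hK).inter_right
    (isClosed_isBarycenter ι)).image continuous_fst).isClosed
  have hSconvex : Convex ℝ S := by
    rintro _ ⟨⟨μ₁, x₁⟩, ⟨⟨hμ₁, hx₁⟩, h₁⟩, rfl⟩ _ ⟨⟨μ₂, x₂⟩, ⟨⟨hμ₂, hx₂⟩, h₂⟩, rfl⟩ a b ha hb hab
    exact ⟨(a • μ₁ + b • μ₂, a • x₁ + b • x₂), ⟨⟨convex_stateSpace X hμ₁ hμ₂ ha hb hab,
      hKc hx₁ hx₂ ha hb hab⟩, h₁.convexCombination h₂ a b⟩, rfl⟩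
  have hpoints : range pointState ⊆ S := by
    rintro _ ⟨z, rfl⟩
    exact ⟨(pointState z, ι z), ⟨⟨pointState_mem_stateSpace z, hι z⟩,
      isBarycenter_pointState ι z⟩, rfl⟩
  rw [← closedConvexHull_range_pointState] at hμ
  obtain ⟨⟨_, x⟩, ⟨⟨-, hx⟩, hμx⟩, rfl⟩ := closedConvexHull_min hpoints hSconvex hSclosed hμ
  exact ⟨x, hx, hμx⟩

variable [IsTopologicalAddGroup E] [ContinuousSMul ℝ E] [LocallyConvexSpace ℝ E] [T2Space E]

theorem IsBarycenter.unique (hx : IsBarycenter ι μ x) (hy : IsBarycenter ι μ y) : x = y := by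
  by_contra hne
  obtain ⟨l, hl⟩ := geometric_hahn_banach_point_point hne
  exact hl.ne ((hx l).symm.trans (hy l))

theorem isExtreme_setOf_isBarycenter (hK : IsCompact K) (hKc : Convex ℝ K) (hι : ∀ z, ι z ∈ K)
    (he : e ∈ K.extremePoints ℝ) :
    IsExtreme ℝ (stateSpace X) {μ ∈ stateSpace X | IsBarycenter ι μ e} where
  subset := sep_subset _ _
  left_mem_of_mem_openSegment := by
    rintro μ hμ ν hν _ ⟨-, hρ⟩ ⟨a, b, ha, hb, hab, rfl⟩
    obtain ⟨x, hx, hμx⟩ := exists_isBarycenter hK hKc hι hμ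
    obtain ⟨y, hy, hνy⟩ := exists_isBarycenter hK hKc hι hν
    have hxe : x = e := (mem_extremePoints_iff_left.1 he).2 x hx y hy
      ⟨a, b, ha, hb, hab, (hμx.convexCombination hνy a b).unique hρ⟩
    exact ⟨hμ, hxe ▸ hμx⟩

/-- **Bauer's characterization** of extreme points. By the Krein-Milman theorem it suffices to look
at the extreme points of the face of all states with barycenter `e`. -/
theorem eq_pointState_of_isBarycenter (hK : IsCompact K) (hKc : Convex ℝ K) (hι : ∀ z, ι z ∈ K)
    (hinj : Function.Injective ι) (he : e ∈ K.extremePoints ℝ) (hμ : μ ∈ stateSpace X)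
    (hμe : IsBarycenter ι μ e) : ∃ z, ι z = e ∧ μ = pointState z := by
  let F : Set (Functional X) := {μ ∈ stateSpace X | IsBarycenter ι μ e}
  have hFcompact : IsCompact F := (isCompact_stateSpace X).inter_right
    ((isClosed_isBarycenter ι).preimage (Continuous.prodMk_left e))
  have hFconvex : Convex ℝ F := fun μ₁ h₁ μ₂ h₂ a b ha hb hab =>
    ⟨convex_stateSpace X h₁.1 h₂.1 ha hb hab, by
      simpa only [← add_smul, hab, one_smul] using h₁.2.convexCombination h₂.2 a b⟩
  have hFextreme : ∀ ν ∈ F.extremePoints ℝ, ∃ z, ι z = e ∧ ν = pointState z := fun ν hν => by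
    obtain ⟨z, rfl⟩ := extremePoints_stateSpace_subset
      ((isExtreme_setOf_isBarycenter hK hKc hι he).extremePoints_subset_extremePoints hν)
    exact ⟨z, (isBarycenter_pointState ι z).unique hν.1.2, rfl⟩
  obtain ⟨ν, hν⟩ := hFcompact.extremePoints_nonempty ⟨μ, hμ, hμe⟩
  obtain ⟨z, hz, -⟩ := hFextreme ν hν
  have hFsub : F.extremePoints ℝ ⊆ {pointState z} := fun ν' hν' => by
    obtain ⟨z', hz', rfl⟩ := hFextreme ν' hν'
    rw [hinj (hz'.trans hz.symm), mem_singleton_iff]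
  refine ⟨z, hz, mem_singleton_iff.1 ?_⟩
  have hμF : μ ∈ closure (convexHull ℝ (F.extremePoints ℝ)) := by
    rw [closure_convexHull_extremePoints hFcompact hFconvex]
    exact ⟨hμ, hμe⟩
  exact closure_minimal (convexHull_min hFsub (convex_singleton _)) isClosed_singleton hμF

end Barycenter

/-! ### Affine flows and boundaries -/

section AffineFlow

variable {G E : Type*} [Group G] [AddCommGroup E] [Module ℝ E] [TopologicalSpace E]
  [DistribMulAction G E] {K : Set E} {x : E}

variable (G) in
/-- `K` is an affine flow for the linear action of `G` on `E`: a nonempty compact convex invariant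
set. The irreducible affine flows are those with `Minimal (IsAffineFlow G) K`. -/
structure IsAffineFlow (K : Set E) : Prop where
  isCompact : IsCompact K
  convex : Convex ℝ K
  nonempty : K.Nonempty
  smul_mem : ∀ (s : G), ∀ x ∈ K, s • x ∈ K

theorem IsAffineFlow.exists_minimal [T2Space E] (hK : IsAffineFlow G K) :
    ∃ L ⊆ K, Minimal (IsAffineFlow G) L := by
  refine zorn_superset_nonempty {L : Set E | IsAffineFlow G L} ?_ K hK
  intro c hc hchain ⟨L, hL⟩
  have : Nonempty c := ⟨⟨L, hL⟩⟩
  refine ⟨⋂₀ c, ⟨(hc hL).isCompact.of_isClosed_subset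
    (isClosed_sInter fun M hM => (hc hM).isCompact.isClosed) (sInter_subset_of_mem hL),
    convex_sInter fun M hM => (hc hM).convex, ?_,
    fun s x hx M hM => (hc hM).smul_mem s x (hx M hM)⟩, fun M hM => sInter_subset_of_mem hM⟩
  exact IsCompact.nonempty_sInter_of_directed_nonempty_isCompact_isClosed
    (show IsChain (· ⊇ ·) c from hchain.symm).directedOn (fun M hM => (hc hM).nonempty)
    (fun M hM => (hc hM).isCompact) fun M hM => (hc hM).isCompact.isClosed

variable [ContinuousConstSMul G E] [SMulCommClass G ℝ E]

theorem IsAffineFlow.closedConvexHull_orbit [T2Space E] (hK : IsAffineFlow G K) (hx : x ∈ K) :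
    IsAffineFlow G (closedConvexHull ℝ (MulAction.orbit G x)) where
  isCompact := hK.isCompact.of_isClosed_subset isClosed_closedConvexHull <|
    closedConvexHull_min (range_subset_iff.2 fun s => hK.smul_mem s x hx) hK.convex
      hK.isCompact.isClosed
  convex := convex_closedConvexHull
  nonempty := ⟨x, subset_closedConvexHull (MulAction.mem_orbit_self x)⟩
  smul_mem s := by
    refine closedConvexHull_min (t := (s • ·) ⁻¹' closedConvexHull ℝ (MulAction.orbit G x))
      (fun y hy => subset_closedConvexHull (MulAction.mem_orbit_of_mem_orbit s hy)) ?_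
      (isClosed_closedConvexHull.preimage (continuous_const_smul s))
    exact convex_closedConvexHull.linear_preimage (DistribSMul.toLinearMap ℝ E s)

theorem extremePoints_subset_closure_orbit [IsTopologicalAddGroup E] [ContinuousSMul ℝ E]
    [LocallyConvexSpace ℝ E] [T2Space E]
    (hK : Minimal (IsAffineFlow G) K) (hx : x ∈ K) :
    K.extremePoints ℝ ⊆ closure (MulAction.orbit G x) := by
  have horbit : MulAction.orbit G x ⊆ K := range_subset_iff.2 fun s => hK.prop.smul_mem s x hx
  have hhull : closedConvexHull ℝ (closure (MulAction.orbit G x)) = K := by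
    rw [closedConvexHull_closure_eq_closedConvexHull]
    exact hK.eq_of_subset (hK.prop.closedConvexHull_orbit hx)
      (closedConvexHull_min horbit hK.prop.convex hK.prop.isCompact.isClosed)
  have hmilman := extremePoints_closedConvexHull_subset
    (hK.prop.isCompact.closure_of_subset horbit) (hhull ▸ hK.prop.isCompact)
  rwa [hhull] at hmilman

theorem IsAffineFlow.smul_mem_closure_extremePoints (hK : IsAffineFlow G K)
    (s : G) (hx : x ∈ closure (K.extremePoints ℝ)) : s • x ∈ closure (K.extremePoints ℝ) := by
  refine map_mem_closure (continuous_const_smul s) hx fun y hy => ?_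
  have hsK : DistribMulAction.toLinearEquiv ℝ E s '' K = K := by
    refine subset_antisymm (image_subset_iff.2 fun y hy => hK.smul_mem s y hy) fun y hy =>
      ⟨s⁻¹ • y, hK.smul_mem s⁻¹ y hy, smul_inv_smul s y⟩
  rw [← hsK, ← image_extremePoints]
  exact mem_image_of_mem _ hy

/-- The closure of the set of extreme points of an affine flow, as a `G`-space. -/
def extremalBoundary (hK : IsAffineFlow G K) : SubMulAction G E where
  carrier := closure (K.extremePoints ℝ)
  smul_mem' s _ := hK.smul_mem_closure_extremePoints s

instance (S : SubMulAction G E) : ContinuousConstSMul G S :=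
  IsInducing.subtypeVal.continuousConstSMul id rfl

end AffineFlow

section StateAction

variable {G Z Y : Type*} [Group G] [TopologicalSpace Z] [MulAction G Z] [ContinuousConstSMul G Z]
  [TopologicalSpace Y] [MulAction G Y] [ContinuousConstSMul G Y]

noncomputable instance : DistribMulAction G (Functional Z) where
  smul s φ := Functional.map ⟨fun z => s • z, continuous_const_smul s⟩ φ
  one_smul φ := Functional.ext fun f => congrArg φ (by ext z; exact congrArg f (one_smul G z))
  mul_smul s t φ :=
    Functional.ext fun f => congrArg φ (by ext z; exact congrArg f (mul_smul s t z))
  smul_zero _ := map_zero _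
  smul_add _ := map_add _

theorem Functional.group_smul_apply (s : G) (φ : Functional Z) (f : Z →ᵇ ℝ) :
    (s • φ) f = φ (f.compContinuous ⟨fun z => s • z, continuous_const_smul s⟩) := rfl

instance : ContinuousConstSMul G (Functional Z) where
  continuous_const_smul s :=
    (Functional.map ⟨fun z : Z => s • z, continuous_const_smul s⟩).continuous

instance : SMulCommClass G ℝ (Functional Z) where
  smul_comm s c φ := map_smul (Functional.map ⟨fun z : Z => s • z, continuous_const_smul s⟩) c φ

theorem Functional.map_smul_of_equivariant {h : C(Z, Y)} (hh : ∀ (s : G) z, h (s • z) = s • h z)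
    (s : G) (φ : Functional Z) : Functional.map h (s • φ) = s • Functional.map h φ :=
  Functional.ext fun f => congrArg φ (by ext z; exact congrArg f (hh s z))

theorem smul_pointState (s : G) (z : Z) : s • pointState z = pointState (s • z) := rfl

variable (G Z) in
theorem isAffineFlow_stateSpace [Nonempty Z] : IsAffineFlow G (stateSpace Z) where
  isCompact := isCompact_stateSpace Z
  convex := convex_stateSpace Z
  nonempty := ⟨pointState (Classical.arbitrary Z), pointState_mem_stateSpace _⟩
  smul_mem s _ hφ := map_mem_stateSpace ⟨fun z => s • z, continuous_const_smul s⟩ hφ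

variable (G Z) in
/-- Strong proximality in terms of states instead of measures: the weak-* closure of the orbit of
every state contains a point evaluation. -/
def IsStateProximal : Prop :=
  ∀ φ ∈ stateSpace Z, ∃ z : Z, pointState z ∈ closure (MulAction.orbit G φ)

end StateAction

section ExtremalBoundary

variable {G E : Type*} [Group G] [AddCommGroup E] [Module ℝ E] [TopologicalSpace E]
  [DistribMulAction G E] [ContinuousConstSMul G E] [SMulCommClass G ℝ E] {K : Set E}

theorem IsBarycenter.smul {X : Type*} [TopologicalSpace X] [CompactSpace X] [MulAction G X]
    [ContinuousConstSMul G X] {ι : C(X, E)} (hι : ∀ (s : G) z, ι (s • z) = s • ι z)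
    {μ : Functional X} {x : E} (hμ : IsBarycenter ι μ x) (s : G) :
    IsBarycenter ι (s • μ) (s • x) := fun l => by
  let l' : E →L[ℝ] ℝ := l.comp ⟨DistribSMul.toLinearMap ℝ E s, continuous_const_smul s⟩
  refine Eq.trans (congrArg μ ?_) (hμ l')
  ext z
  exact congrArg l (hι s z)

variable [T2Space E]

theorem extremalBoundary_subset (hK : IsAffineFlow G K) : (extremalBoundary hK : Set E) ⊆ K :=
  closure_minimal extremePoints_subset hK.isCompact.isClosed

instance (hK : IsAffineFlow G K) : CompactSpace (extremalBoundary hK) :=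
  isCompact_iff_compactSpace.1 <|
    hK.isCompact.of_isClosed_subset isClosed_closure (extremalBoundary_subset hK)

variable [IsTopologicalAddGroup E] [ContinuousSMul ℝ E] [LocallyConvexSpace ℝ E]

instance (hK : IsAffineFlow G K) : Nonempty (extremalBoundary hK) :=
  ((hK.isCompact.extremePoints_nonempty hK.nonempty).mono subset_closure).to_subtype

theorem isMinimal_extremalBoundary (hK : Minimal (IsAffineFlow G) K) :
    MulAction.IsMinimal G (extremalBoundary hK.prop) where
  dense_orbit x := Subtype.dense_iff.2 <| by
    have himage : MulAction.orbit G (x : E) ⊆ Subtype.val '' MulAction.orbit G x :=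
      range_subset_iff.2 fun s => ⟨s • x, ⟨s, rfl⟩, rfl⟩
    exact (closure_minimal (extremePoints_subset_closure_orbit hK
      (extremalBoundary_subset hK.prop x.2)) isClosed_closure).trans (closure_mono himage)

/-- The orbit of the barycenter of a state accumulates at an extreme point, so the orbit of the
state accumulates at a state with an extreme barycenter, which is a point evaluation. -/
theorem isStateProximal_extremalBoundary (hK : Minimal (IsAffineFlow G) K) :
    IsStateProximal G (extremalBoundary hK.prop) := by
  intro μ hμ
  let B := extremalBoundary hK.prop
  let ι : C(B, E) := ⟨Subtype.val, continuous_subtype_val⟩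
  have hι : ∀ z, ι z ∈ K := fun z => extremalBoundary_subset hK.prop z.2
  have hKcompact := hK.prop.isCompact
  obtain ⟨b, hbK, hb⟩ := exists_isBarycenter hKcompact hK.prop.convex hι hμ
  obtain ⟨e, he⟩ := hKcompact.extremePoints_nonempty hK.prop.nonempty
  let O : Set (Functional B) := closure (MulAction.orbit G μ)
  have hO : O ⊆ stateSpace B := closure_minimal
    (range_subset_iff.2 fun s => map_mem_stateSpace _ hμ) (isClosed_stateSpace B)
  let S : Set E := Prod.snd '' ((O ×ˢ K) ∩ {p | IsBarycenter ι p.1 p.2})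
  have hSclosed : IsClosed S :=
    (((((isCompact_stateSpace B).of_isClosed_subset isClosed_closure hO).prod hKcompact).inter_right
      (isClosed_isBarycenter ι)).image continuous_snd).isClosed
  have hbS : MulAction.orbit G b ⊆ S := range_subset_iff.2 fun s =>
    ⟨(s • μ, s • b), ⟨⟨subset_closure ⟨s, rfl⟩, hK.prop.smul_mem s b hbK⟩,
      hb.smul (fun _ _ => rfl) s⟩, rfl⟩
  obtain ⟨⟨ν, _⟩, ⟨⟨hνO, -⟩, hν⟩, rfl⟩ :=
    closure_minimal hbS hSclosed (extremePoints_subset_closure_orbit hK hbK he)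
  obtain ⟨z, -, rfl⟩ := eq_pointState_of_isBarycenter hKcompact hK.prop.convex hι
    Subtype.val_injective he (hO hνO) hν
  exact ⟨z, hνO⟩

end ExtremalBoundary

section Universal

variable {G X Y : Type*} [Group G] [TopologicalSpace X] [MulAction G X]
  [TopologicalSpace Y] [MulAction G Y]

theorem surjective_of_isMinimal [CompactSpace X] [Nonempty X] [T2Space Y] [MulAction.IsMinimal G Y]
    {f : X → Y} (hf : Continuous f) (hequiv : ∀ (s : G) x, f (s • x) = s • f x) :
    Function.Surjective f := by
  refine range_eq_univ.1 <| (eq_empty_or_univ_of_smul_invariant_closed G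
    (isCompact_range hf).isClosed fun s => ?_).resolve_left (range_nonempty f).ne_empty
  rintro _ ⟨_, ⟨x, rfl⟩, rfl⟩
  exact ⟨s • x, hequiv s x⟩

variable [ContinuousConstSMul G Y] {E : Type*} [AddCommGroup E] [Module ℝ E] [TopologicalSpace E]
  [DistribMulAction G E] [IsTopologicalAddGroup E] [ContinuousSMul ℝ E] [LocallyConvexSpace ℝ E]
  [T2Space E] {K : Set E} {Φ : E →L[ℝ] Functional Y}

theorem exists_extremePoint_apply_eq_pointState (hY : IsStateProximal G Y) (hK : IsAffineFlow G K)
    (hΦ : ∀ (s : G) x, Φ (s • x) = s • Φ x) (hΦK : MapsTo Φ K (stateSpace Y)) :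
    ∃ e ∈ K.extremePoints ℝ, ∃ y, Φ e = pointState y := by
  obtain ⟨x, hx⟩ := hK.nonempty
  obtain ⟨y, hy⟩ := hY (Φ x) (hΦK hx)
  have horbit : MulAction.orbit G (Φ x) ⊆ Φ '' K :=
    range_subset_iff.2 fun s => ⟨s • x, hK.smul_mem s x hx, hΦ s x⟩
  have hyK : pointState y ∈ Φ '' K :=
    closure_minimal horbit (hK.isCompact.image Φ.continuous).isClosed hy
  have hyextreme : pointState y ∈ (Φ '' K).extremePoints ℝ :=
    inter_extremePoints_subset_extremePoints_of_subset hΦK.image_subset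
      ⟨hyK, pointState_mem_extremePoints y⟩
  obtain ⟨e, he, hey⟩ :=
    surjOn_extremePoints_image Φ.toContinuousAffineMap hK.isCompact hyextreme
  exact ⟨e, he, y, hey⟩

variable [ContinuousConstSMul G E] [SMulCommClass G ℝ E]

theorem apply_mem_range_pointState [CompactSpace Y] (hY : IsStateProximal G Y)
    (hK : Minimal (IsAffineFlow G) K) (hΦ : ∀ (s : G) x, Φ (s • x) = s • Φ x)
    (hΦK : MapsTo Φ K (stateSpace Y)) (x : extremalBoundary hK.prop) :
    Φ x ∈ range pointState := by
  obtain ⟨e, he, y, hey⟩ := exists_extremePoint_apply_eq_pointState hY hK.prop hΦ hΦK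
  have := isMinimal_extremalBoundary hK
  let S : Set (extremalBoundary hK.prop) := {x | Φ x ∈ range pointState}
  have hSclosed : IsClosed S := (isCompact_range continuous_pointState).isClosed.preimage
    (Φ.continuous.comp continuous_subtype_val)
  have hSsmul : ∀ s : G, s • S ⊆ S := by
    rintro s _ ⟨x, ⟨y, hxy⟩, rfl⟩
    exact ⟨s • y, by rw [← smul_pointState, hxy, ← hΦ]; rfl⟩
  have hSne : S.Nonempty := ⟨⟨e, subset_closure he⟩, y, hey.symm⟩
  have huniv : S = univ :=
    (eq_empty_or_univ_of_smul_invariant_closed G hSclosed hSsmul).resolve_left hSne.ne_empty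
  exact huniv.ge (mem_univ x)

theorem exists_equivariant_surjection [CompactSpace Y] [T2Space Y] [MulAction.IsMinimal G Y]
    (hY : IsStateProximal G Y) (hK : Minimal (IsAffineFlow G) K)
    (hΦ : ∀ (s : G) x, Φ (s • x) = s • Φ x) (hΦK : MapsTo Φ K (stateSpace Y)) :
    ∃ f : extremalBoundary hK.prop → Y, Continuous f ∧ Function.Surjective f ∧
      ∀ (s : G) x, f (s • x) = s • f x := by
  choose f hf using apply_mem_range_pointState hY hK hΦ hΦK
  have hemb : IsEmbedding (pointState : Y → Functional Y) :=
    (continuous_pointState.isClosedEmbedding pointState_injective).isEmbedding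
  have hcont : Continuous f := hemb.continuous_iff.2 <| by
    simpa only [Function.comp_def, hf] using Φ.continuous.comp continuous_subtype_val
  have hequiv : ∀ (s : G) x, f (s • x) = s • f x := fun s x => pointState_injective <| by
    rw [hf, ← smul_pointState, hf, ← hΦ]
    rfl
  exact ⟨f, hcont, surjective_of_isMinimal hcont hequiv, hequiv⟩

end Universal

section Measure

variable {X : Type*} [TopologicalSpace X] [MeasurableSpace X] [BorelSpace X]

/-- Integration against a probability measure, as a functional. -/
noncomputable def integralState (ν : ProbabilityMeasure X) : Functional X :=
  StrongDual.toWeakDual <| LinearMap.mkContinuous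
    { toFun f := ∫ x, f x ∂(ν : Measure X)
      map_add' f g := integral_add (f.integrable _) (g.integrable _)
      map_smul' c _ := integral_const_mul c _ } 1 fun f => by
    rw [one_mul]
    exact f.norm_integral_le_norm _

theorem integralState_apply (ν : ProbabilityMeasure X) (f : X →ᵇ ℝ) :
    integralState ν f = ∫ x, f x ∂(ν : Measure X) := rfl

theorem integralState_mem_stateSpace (ν : ProbabilityMeasure X) : integralState ν ∈ stateSpace X :=
  ⟨by simp [integralState_apply], fun _ hf => integral_nonneg hf⟩

theorem isInducing_integralState :
    IsInducing (integralState : ProbabilityMeasure X → Functional X) := by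
  refine isInducing_iff_nhds.2 fun ν => le_antisymm ?_ ?_
  · exact map_le_iff_le_comap.1 <| tendsto_iff_forall_eval_tendsto_topDualPairing.2 fun f =>
      ProbabilityMeasure.tendsto_iff_forall_integral_tendsto.1 tendsto_id f
  · refine tendsto_id'.1 <| ProbabilityMeasure.tendsto_iff_forall_integral_tendsto.2 fun f => ?_
    exact ((WeakDual.eval_continuous f).tendsto (integralState ν)).comp tendsto_comap

theorem integralState_diracProba [T1Space X] (x : X) :
    integralState (diracProba x) = pointState x :=
  Functional.ext fun _ => integral_dirac _ _

theorem integralState_map_smul {G : Type*} [Group G] [MulAction G X] [ContinuousConstSMul G X]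
    (s : G) (ν : ProbabilityMeasure X) :
    integralState
        (ν.map (f := fun y : X => s • y) (continuous_const_smul s).measurable.aemeasurable) =
      s • integralState ν :=
  Functional.ext fun f => integral_map (continuous_const_smul s).measurable.aemeasurable
    f.continuous.measurable.aestronglyMeasurable

theorem exists_regular_integralState_eq [CompactSpace X] [T2Space X] {φ : Functional X}
    (hφ : φ ∈ stateSpace X) :
    ∃ ν : ProbabilityMeasure X, (ν : Measure X).Regular ∧ integralState ν = φ := by
  let Λ : CompactlySupportedContinuousMap X ℝ →ₚ[ℝ] ℝ := PositiveLinearMap.mk₀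
    { toFun f := φ (.mkOfCompact f.toContinuousMap)
      map_add' f g := map_add φ (.mkOfCompact f.toContinuousMap) (.mkOfCompact g.toContinuousMap)
      map_smul' c f := map_smul φ c (.mkOfCompact f.toContinuousMap) }
    fun f hf => hφ.2 _ fun x => hf x
  have hintegral : ∀ g : X →ᵇ ℝ, ∫ x, g x ∂(RealRMK.rieszMeasure Λ) = φ g := fun g =>
    RealRMK.integral_rieszMeasure Λ
      { toFun := g, hasCompactSupport' := HasCompactSupport.of_compactSpace _ }
  have hprob : IsProbabilityMeasure (RealRMK.rieszMeasure Λ) := by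
    have hone := hintegral 1
    simp only [BoundedContinuousFunction.coe_one, Pi.one_apply, integral_const, smul_eq_mul,
      mul_one, hφ.1] at hone
    exact ⟨(ENNReal.toReal_eq_one_iff _).1 hone⟩
  exact ⟨⟨RealRMK.rieszMeasure Λ, hprob⟩, inferInstanceAs (RealRMK.rieszMeasure Λ).Regular,
    Functional.ext hintegral⟩

end Measure

theorem isStronglyProximal_iff {G X : Type u} [Group G] [TopologicalSpace X]
    [MulAction G X] [ContinuousConstSMul G X] [CompactSpace X] [T2Space X] :
    IsStronglyProximal G X ↔ IsStateProximal G X := by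
  let : MeasurableSpace X := borel X
  have : BorelSpace X := ⟨rfl⟩
  have hclosure (ν : ProbabilityMeasure X) (x : X) :
      diracProba x ∈ closure (range fun s : G =>
        ν.map (f := fun y : X => s • y) (continuous_const_smul s).measurable.aemeasurable) ↔
      pointState x ∈ closure (MulAction.orbit G (integralState ν)) := by
    rw [isInducing_integralState.closure_eq_preimage_closure_image, mem_preimage, ← range_comp,
      integralState_diracProba]
    simp only [Function.comp_def, integralState_map_smul]
    rfl
  constructor
  · intro h φ hφ
    obtain ⟨ν, hν, rfl⟩ := exists_regular_integralState_eq hφ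
    exact (h ν hν).imp fun x => (hclosure ν x).1
  · intro h ν _
    exact (h _ (integralState_mem_stateSpace ν)).imp fun x => (hclosure ν x).2

section Existence

theorem isBoundary_extremalBoundary {G E : Type u} [Group G] [AddCommGroup E] [Module ℝ E]
    [TopologicalSpace E] [DistribMulAction G E] [ContinuousConstSMul G E] [SMulCommClass G ℝ E]
    [T2Space E] [IsTopologicalAddGroup E] [ContinuousSMul ℝ E] [LocallyConvexSpace ℝ E]
    {K : Set E} (hK : Minimal (IsAffineFlow G) K) : IsBoundary G (extremalBoundary hK.prop) where
  compact := inferInstance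
  hausdorff := inferInstance
  nonempty := inferInstance
  minimal := isMinimal_extremalBoundary hK
  stronglyProximal := isStronglyProximal_iff.2 (isStateProximal_extremalBoundary hK)

variable {G : Type u} [Group G]

theorem isFurstenbergBoundary_extremalBoundary [TopologicalSpace G] [DiscreteTopology G]
    {K : Set (Functional G)} (hK : Minimal (IsAffineFlow G) K) (hKsub : K ⊆ stateSpace G) :
    IsFurstenbergBoundary G (extremalBoundary hK.prop) where
  isBoundary := isBoundary_extremalBoundary hK
  universal Y _ _ _ hY := by
    have := hY.compact
    have := hY.hausdorff
    have := hY.minimal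
    obtain ⟨y⟩ := hY.nonempty
    let orbitMap : C(G, Y) := ⟨fun s => s • y, continuous_of_discreteTopology⟩
    exact exists_equivariant_surjection (isStronglyProximal_iff.1 hY.stronglyProximal) hK
      (Functional.map_smul_of_equivariant (h := orbitMap) fun s t => mul_smul s t y)
      fun _ hφ => map_mem_stateSpace orbitMap (hKsub hφ)

variable (G) in
theorem exists_isFurstenbergBoundary :
    ∃ (X : Type u) (_ : TopologicalSpace X) (_ : MulAction G X) (_ : ContinuousConstSMul G X),
      IsFurstenbergBoundary G X := by
  let : TopologicalSpace G := ⊥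
  have : DiscreteTopology G := ⟨rfl⟩
  obtain ⟨K, hKsub, hK⟩ := (isAffineFlow_stateSpace G G).exists_minimal
  exact ⟨_, _, _, _, isFurstenbergBoundary_extremalBoundary hK hKsub⟩

end Existence

section Amenability

/-- The real part of a bounded complex function, as a real-linear map. -/
noncomputable def rePart (G : Type*) [TopologicalSpace G] [DiscreteTopology G] :
    lp (fun _ : G => ℂ) ∞ →ₗ[ℝ] (G →ᵇ ℝ) where
  toFun f := .ofNormedAddCommGroup (fun t => (f t).re) continuous_of_discreteTopology ‖f‖
    fun t => (Complex.abs_re_le_norm _).trans (lp.norm_apply_le_norm ENNReal.top_ne_zero f t)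
  map_add' _ _ := rfl
  map_smul' c f := by
    ext t
    exact Complex.re_ofReal_mul c (f t)

theorem rePart_apply {G : Type*} [TopologicalSpace G] [DiscreteTopology G]
    (f : lp (fun _ : G => ℂ) ∞) (t : G) : rePart G f t = (f t).re := rfl

variable {G : Type u} [Group G]

theorem isAmenable_of_fixed_state [TopologicalSpace G] [DiscreteTopology G] {φ : Functional G}
    (hφ : φ ∈ stateSpace G) (hfix : ∀ s : G, s • φ = φ) : IsAmenable G := by
  let m : Module.Dual ℝ (lp (fun _ : G => ℂ) ∞) :=
    LinearMap.comp (φ : (G →ᵇ ℝ) →ₗ[ℝ] ℝ) (rePart G)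
  have hm (f : lp (fun _ : G => ℂ) ∞) : m f = φ (rePart G f) := rfl
  have hmI {f : lp (fun _ : G => ℂ) ∞} (hf : ∀ t, (f t).im = 0) : m (Complex.I • f) = 0 := by
    have hre : rePart G (Complex.I • f) = 0 := by
      ext t
      simp [rePart_apply, hf]
    rw [hm, hre, map_zero]
  have hinvariant {s : G} {f g : lp (fun _ : G => ℂ) ∞} (hfg : ∀ t, g t = f (s⁻¹ * t)) :
      m g = m f := by
    rw [hm, hm, ← DFunLike.congr_fun (hfix s⁻¹) (rePart G f), Functional.group_smul_apply]
    congr 1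
    ext t
    exact congrArg Complex.re (hfg t)
  refine ⟨m.extendRCLike, ?_, fun f hf => ?_, fun s f g hfg => ?_⟩
  · have hone : rePart G 1 = 1 := by
      ext
      simp [rePart_apply]
    have hI : m (Complex.I • 1) = 0 := hmI fun _ => by simp
    simp [Module.Dual.extendRCLike_apply, hm 1, hone, hφ.1, hI]
  · have hre : 0 ≤ m f := hφ.2 _ fun t => (Complex.nonneg_iff.1 (hf t)).1
    simpa [Module.Dual.extendRCLike_apply, hmI fun t => (Complex.nonneg_iff.1 (hf t)).2.symm]
      using hre
  · have hI : m (Complex.I • g) = m (Complex.I • f) :=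
      hinvariant (s := s) fun t => by simp [hfg]
    simp [Module.Dual.extendRCLike_apply, hinvariant hfg, hI]

theorem IsFurstenbergBoundary.exists_smul_ne {X : Type u} [TopologicalSpace X] [MulAction G X]
    [ContinuousConstSMul G X] (hX : IsFurstenbergBoundary G X) (hG : ¬ IsAmenable G) (x : X) :
    ∃ s : G, s • x ≠ x := by
  by_contra! hfix
  let : TopologicalSpace G := ⊥
  have : DiscreteTopology G := ⟨rfl⟩
  obtain ⟨K, hKsub, hK⟩ := (isAffineFlow_stateSpace G G).exists_minimal
  obtain ⟨f, -, -, hf⟩ := hX.universal _ (isBoundary_extremalBoundary hK)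
  refine hG (isAmenable_of_fixed_state (φ := (f x).1)
    (hKsub (extremalBoundary_subset hK.prop (f x).2)) fun s => ?_)
  rw [← SubMulAction.val_smul, ← hf, hfix]

end Amenability

/-! ### Tarski monsters -/

section TarskiMonster

variable {G : Type u} [Group G] {p : ℕ} {H K : Subgroup G} {s : G}

theorem IsTarskiMonster.finite_of_ne_top (hG : IsTarskiMonster G p) (hH : H ≠ ⊤) : Finite H := by
  rcases eq_or_ne H ⊥ with rfl | hbot
  · infer_instance
  · exact Nat.finite_of_card_ne_zero ((hG.cyclic H hbot hH).2 ▸ hG.prime.ne_zero)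

theorem IsTarskiMonster.eq_of_le (hG : IsTarskiMonster G p) (hH : H ≠ ⊥) (hHK : H ≤ K)
    (hK : K ≠ ⊤) : H = K := by
  have := hG.finite_of_ne_top hK
  refine Subgroup.eq_of_le_of_card_ge hHK ?_
  rw [(hG.cyclic H hH (ne_top_of_le_ne_top hK hHK)).2,
    (hG.cyclic K (ne_bot_of_le_ne_bot hH hHK) hK).2]

theorem IsTarskiMonster.isOfFinOrder (hG : IsTarskiMonster G p) (s : G) : IsOfFinOrder s := by
  by_cases htop : Subgroup.zpowers (s ^ 2) = ⊤
  · obtain ⟨k, hk⟩ := Subgroup.mem_zpowers_iff.1 (htop.ge (Subgroup.mem_top s))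
    refine isOfFinOrder_iff_zpow_eq_one.2 ⟨2 * k - 1, by omega, ?_⟩
    rw [zpow_sub_one, zpow_mul, zpow_ofNat, hk, mul_inv_cancel]
  · have := hG.finite_of_ne_top htop
    exact (isOfFinOrder_pow.1 (finite_zpowers.1 (toFinite _))).resolve_right two_ne_zero

theorem IsTarskiMonster.zpowers_ne_top (hG : IsTarskiMonster G p) (s : G) :
    Subgroup.zpowers s ≠ ⊤ := fun htop => by
  have := hG.infinite
  have hfin := finite_zpowers.2 (hG.isOfFinOrder s)
  exact infinite_univ (by simpa [htop] using hfin)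

theorem IsTarskiMonster.not_normal (hG : IsTarskiMonster G p) (hbot : H ≠ ⊥) (htop : H ≠ ⊤) :
    ¬ H.Normal := fun hnormal => by
  have := hG.infinite
  have := hG.finite_of_ne_top htop
  obtain ⟨t, -, ht⟩ := SetLike.exists_of_lt htop.lt_top
  have hsup : H ⊔ Subgroup.zpowers t = ⊤ := by
    by_contra hne
    exact ht ((hG.eq_of_le hbot le_sup_left hne).ge
      (Subgroup.mem_sup_right (Subgroup.mem_zpowers t)))
  have huniv : (H : Set G) * (Subgroup.zpowers t : Set G) = univ := by
    rw [← Subgroup.normal_mul, hsup, Subgroup.coe_top]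
  exact infinite_univ (huniv ▸ (toFinite (H : Set G)).mul
    (finite_zpowers.2 (hG.isOfFinOrder t)))

theorem IsTarskiMonster.centralizer_ne_top (hG : IsTarskiMonster G p) (hs : s ≠ 1) :
    Subgroup.centralizer {s} ≠ ⊤ := fun htop => by
  refine hG.not_normal (Subgroup.zpowers_ne_bot.2 hs) (hG.zpowers_ne_top s) ?_
  have hcenter : s ∈ Subgroup.center G := Subgroup.mem_center_iff.2 fun g =>
    Subgroup.mem_centralizer_singleton_iff.1 (htop.ge (Subgroup.mem_top g))
  refine ⟨fun n hn g => ?_⟩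
  rwa [Subgroup.mem_center_iff.1 (Subgroup.zpowers_le.2 hcenter hn) g, mul_inv_cancel_right]

theorem IsTarskiMonster.infinite_conjugacyClass (hG : IsTarskiMonster G p) (hs : s ≠ 1) :
    (MulAction.orbit (ConjAct G) s).Infinite := fun horbit => by
  have hfin := hG.finite_of_ne_top (hG.centralizer_ne_top hs)
  have hindex : (Subgroup.centralizer {s}).FiniteIndex := by
    refine ⟨fun hzero => ?_⟩
    have hcard : (MulAction.orbit (ConjAct G) s).ncard = 0 := by
      rw [← MulAction.index_stabilizer, ConjAct.stabilizer_eq_centralizer]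
      exact hzero
    exact (MulAction.nonempty_orbit s).ne_empty ((ncard_eq_zero horbit).1 hcard)
  exact not_finite_iff_infinite.2 hG.infinite
    ((Subgroup.finite_iff_finite_and_finiteIndex (Subgroup.centralizer {s})).2 ⟨hfin, hindex⟩)

theorem IsTarskiMonster.stabilizer_eq_zpowers {X : Type*} [MulAction G X]
    (hG : IsTarskiMonster G p) (hs : s ≠ 1) {x : X} (hsx : s • x = x) (hx : ∃ t : G, t • x ≠ x) :
    MulAction.stabilizer G x = Subgroup.zpowers s := by
  refine (hG.eq_of_le (Subgroup.zpowers_ne_bot.2 hs) (Subgroup.zpowers_le.2 hsx)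
    fun htop => ?_).symm
  obtain ⟨t, ht⟩ := hx
  exact ht (htop.ge (Subgroup.mem_top t))

theorem IsTarskiMonster.isTopologicallyFree {X : Type u} [TopologicalSpace X] [MulAction G X]
    [ContinuousConstSMul G X] [CompactSpace X] [MulAction.IsMinimal G X]
    (hG : IsTarskiMonster G p) (hfix : ∀ x : X, ∃ s : G, s • x ≠ x) : IsTopologicallyFree G X := by
  intro s hs
  by_contra hdense
  set U := interior {x : X | s • x = x}
  have hU : U.Nonempty :=
    nonempty_iff_ne_empty.2 fun h => hdense (interior_eq_empty_iff_dense_compl.1 h)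
  have hUfix : ∀ u ∈ U, s • u = u := fun u hu =>
    (interior_subset hu : u ∈ {x : X | s • x = x})
  obtain ⟨I, hI⟩ := isCompact_univ.exists_finite_cover_smul G isOpen_interior hU
  obtain ⟨u₀, hu₀⟩ := hU
  refine hG.infinite_conjugacyClass hs <| Finite.subset (I.finite_toSet.biUnion fun t _ =>
    (finite_zpowers.2 (hG.isOfFinOrder s)).image (MulAut.conj t)) ?_
  rintro _ ⟨g, rfl⟩
  obtain ⟨t, ht, u, hu, htu⟩ := mem_iUnion₂.1 (hI (mem_univ (ConjAct.ofConjAct g • u₀)))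
  have hconj : g • s ∈ MulAction.stabilizer G (ConjAct.ofConjAct g • u₀) := by
    rw [MulAction.mem_stabilizer_iff, ConjAct.smul_def, mul_smul, mul_smul, inv_smul_smul,
      hUfix u₀ hu₀]
  rw [← show t • u = ConjAct.ofConjAct g • u₀ from htu,
    MulAction.stabilizer_smul_eq_stabilizer_map_conj,
    hG.stabilizer_eq_zpowers hs (hUfix u hu) (hfix u)] at hconj
  exact mem_iUnion₂.2 ⟨t, ht, hconj⟩

end TarskiMonster

/-! ### Functionals on a C*-algebra that restrict to characters -/

section Multiplicative

theorem apply_eq_zero_of_norm_sq_add_smul_le {E : Type*} [NormedAddCommGroup E] [NormedSpace ℂ E]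
    {φ : StrongDual ℂ E} (hφ : ‖φ‖ ≤ 1) {a b : E} (ha : (φ a).re = 1) {C : ℝ}
    (h : ∀ z : ℂ, ‖a + z • b‖ ^ 2 ≤ 1 + (‖z‖ * C) ^ 2) : φ b = 0 := by
  by_contra hne
  have hquadratic {r : ℝ} (hr : 0 ≤ r) : (1 + r * ‖φ b‖ ^ 2) ^ 2 ≤ 1 + (r * ‖φ b‖ * C) ^ 2 := by
    have hre : (φ (a + ((r : ℂ) * starRingEnd ℂ (φ b)) • b)).re = 1 + r * ‖φ b‖ ^ 2 := by
      rw [map_add, map_smul, Complex.add_re, ha, smul_eq_mul, mul_assoc,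
        ← Complex.normSq_eq_conj_mul_self, Complex.normSq_eq_norm_sq, ← Complex.ofReal_mul,
        Complex.ofReal_re]
    calc (1 + r * ‖φ b‖ ^ 2) ^ 2 ≤ ‖a + ((r : ℂ) * starRingEnd ℂ (φ b)) • b‖ ^ 2 := by
          rw [← hre]
          gcongr
          · rw [hre]
            positivity
          · exact (Complex.re_le_norm _).trans (φ.le_of_opNorm_le_of_le hφ le_rfl |>.trans_eq
              (one_mul _))
      _ ≤ 1 + (r * ‖φ b‖ * C) ^ 2 := by
          simpa [abs_of_nonneg hr] using h ((r : ℂ) * starRingEnd ℂ (φ b))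
  have hC : 0 < C ^ 2 + 1 := by positivity
  have hr : (C ^ 2 + 1)⁻¹ * C ^ 2 < 1 := by
    rw [inv_mul_lt_iff₀ hC]
    linarith
  have hrpos : 0 < (C ^ 2 + 1)⁻¹ * ‖φ b‖ ^ 2 := by positivity
  nlinarith [hquadratic (inv_nonneg.2 hC.le), mul_lt_mul_of_pos_left hr hrpos]

variable {A : Type*} [CStarAlgebra A] [PartialOrder A] [StarOrderedRing A] {a b : A}

theorem norm_sq_add_mul_le (ha : IsSelfAdjoint a) (hb : IsSelfAdjoint b) (hab : Commute a b)
    (h : a * a + b * b = 1) (c : A) : ‖a + b * c‖ ^ 2 ≤ 1 + ‖c‖ ^ 2 := by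
  nontriviality A
  have hpythagoras : star (a + b * c) * (a + b * c) + star (b - a * c) * (b - a * c) =
      1 + star c * c := by
    calc _ = (a * a + b * b) + star c * (a * a + b * b) * c +
          ((a * b - b * a) * c + star c * (b * a - a * b)) := by
          simp only [star_add, star_sub, star_mul, ha.star_eq, hb.star_eq]
          noncomm_ring
      _ = 1 + star c * c := by simp [h, hab.eq]
  rw [pow_two, ← CStarRing.norm_star_mul_self, pow_two, ← CStarRing.norm_star_mul_self]
  calc ‖star (a + b * c) * (a + b * c)‖ ≤ ‖1 + star c * c‖ :=
        CStarAlgebra.norm_le_norm_of_nonneg_of_le (star_mul_self_nonneg _)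
          (hpythagoras ▸ le_add_of_nonneg_right (star_mul_self_nonneg _))
    _ ≤ 1 + ‖star c * c‖ := (norm_add_le _ _).trans_eq (by rw [CStarRing.norm_one])

variable {φ : StrongDual ℂ A}

theorem apply_mul_eq_zero_of_re_apply_eq_one (hφ : ‖φ‖ ≤ 1) (ha : IsSelfAdjoint a)
    (hb : IsSelfAdjoint b) (hab : Commute a b) (h : a * a + b * b = 1) (hone : (φ a).re = 1)
    (c : A) : φ (b * c) = 0 ∧ φ (c * b) = 0 := by
  constructor <;> refine apply_eq_zero_of_norm_sq_add_smul_le hφ hone (C := ‖c‖) fun z => ?_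
  · rw [← norm_smul, ← mul_smul_comm]
    exact norm_sq_add_mul_le ha hb hab h _
  · rw [← norm_star, ← norm_smul, ← norm_star (z • c), star_add, ← smul_mul_assoc, star_mul,
      ha.star_eq, hb.star_eq]
    exact norm_sq_add_mul_le ha hb hab h _

variable {X : Type*} [TopologicalSpace X]

theorem exists_mul_self_add_mul_self_eq_one (f : X →ᵇ ℝ) {y : X} (hy : f y = 0) :
    ∃ a b : X →ᵇ ℝ, a * a + b * b = 1 ∧ a y = 1 ∧ f = ‖f‖ • b := by
  let b : X →ᵇ ℝ := ‖f‖⁻¹ • f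
  have hb (x : X) : b x * b x ≤ 1 := by
    rw [← abs_le_one_iff_mul_self_le_one, ← Real.norm_eq_abs]
    exact (b.norm_coe_le_norm x).trans (by simpa [b, norm_smul] using inv_mul_le_one)
  have hcont : Continuous fun x => √(1 - b x * b x) := by fun_prop
  refine ⟨.ofNormedAddCommGroup _ hcont 1 fun x => ?_, b, ?_, ?_, ?_⟩
  · rw [Real.norm_of_nonneg (Real.sqrt_nonneg _), Real.sqrt_le_one]
    nlinarith [mul_self_nonneg (b x)]
  · ext x
    exact (congrArg (· + b x * b x) (Real.mul_self_sqrt (sub_nonneg.2 (hb x)))).trans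
      (sub_add_cancel 1 _)
  · simp [b, hy]
  · rcases eq_or_ne f 0 with rfl | hf
    · simp
    · exact (smul_inv_smul₀ (norm_ne_zero_iff.2 hf) f).symm

theorem apply_mul_of_re_apply_eq (hφ : ‖φ‖ ≤ 1) {π : (X →ᵇ ℝ) →⋆ₐ[ℝ] A} {y : X}
    (hy : ∀ f, (φ (π f)).re = f y) (f : X →ᵇ ℝ) (c : A) :
    φ (π f * c) = f y * φ c ∧ φ (c * π f) = f y * φ c := by
  obtain ⟨a, b, hab, hay, hfb⟩ := exists_mul_self_add_mul_self_eq_one (f - f y • 1) (y := y)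
    (by simp)
  have hself (g : X →ᵇ ℝ) : IsSelfAdjoint (π g) :=
    IsSelfAdjoint.map (BoundedContinuousFunction.ext fun x => star_trivial (g x)) π
  obtain ⟨hleft, hright⟩ := apply_mul_eq_zero_of_re_apply_eq_one hφ (hself a) (hself b)
    ((Commute.all a b).map π) (by rw [← map_mul, ← map_mul, ← map_add, hab, map_one])
    ((hy a).trans hay) c
  have hπ : π f = f y • 1 + ‖f - f y • 1‖ • π b := by
    rw [← map_smul, ← hfb, map_sub, map_smul, map_one, add_sub_cancel]
  have hreal (r : ℝ) (d : A) : φ (r • d) = r * φ d := by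
    rw [← Complex.coe_smul, map_smul, smul_eq_mul]
  simp [hπ, add_mul, mul_add, hreal, hleft, hright]

end Multiplicative

/-! ### The regular representation -/

section RegularRepresentation

variable {G : Type u}

/-- The canonical orthonormal basis vectors of `ℓ²(G)`. -/
noncomputable def delta (t : G) : ell2 G :=
  open Classical in lp.single 2 t 1

theorem inner_delta (t : G) (ξ : ell2 G) : inner ℂ (delta t) ξ = ξ t := by
  classical
  simp [delta, lp.inner_single_left]

theorem delta_apply_self (t : G) : delta t t = 1 := by
  classical
  exact lp.single_apply_self 2 t 1

theorem delta_apply_ne {s t : G} (h : s ≠ t) : delta t s = 0 := by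
  classical
  exact lp.single_apply_ne 2 t 1 h

theorem eq_zero_of_apply_delta {T : ell2 G →L[ℂ] ell2 G} (h : ∀ t, T (delta t) = 0) : T = 0 := by
  classical
  ext1 ξ
  have hterm (t : G) : T (lp.single 2 t (ξ t)) = 0 := by
    rw [show lp.single 2 t (ξ t) = ξ t • delta t by
      rw [delta, ← lp.single_smul, smul_eq_mul, mul_one], map_smul, h, smul_zero]
  have hsum : HasSum (fun t => T (lp.single 2 t (ξ t))) (T ξ) :=
    (lp.hasSum_single (p := 2) (by norm_num) ξ).mapL T
  simp only [hterm] at hsum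
  exact hsum.unique hasSum_zero

variable [Group G]

theorem leftRegular_apply (s : G) (ξ : ell2 G) (t : G) : leftRegular s ξ t = ξ (s⁻¹ * t) := rfl

theorem leftRegular_one : leftRegular (1 : G) = 1 := by
  ext ξ t
  rw [leftRegular_apply, inv_one, one_mul, one_apply_eq_self]

theorem leftRegular_mul (s t : G) : leftRegular (s * t) = leftRegular s * leftRegular t := by
  ext ξ r
  simp only [mul_apply_eq_comp, leftRegular_apply, mul_inv_rev, mul_assoc]

theorem star_leftRegular (s : G) : star (leftRegular s) = leftRegular s⁻¹ := by
  have hisometry : star (leftRegular s) * leftRegular s = 1 :=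
    (ContinuousLinearMap.norm_map_iff_adjoint_comp_self _).1 (leftRegularIsometry s).norm_map
  refine left_inv_eq_right_inv hisometry ?_
  rw [← leftRegular_mul, mul_inv_cancel, leftRegular_one]

theorem norm_leftRegular_le (s : G) : ‖leftRegular s‖ ≤ 1 :=
  LinearIsometry.norm_toContinuousLinearMap_le _

theorem leftRegular_delta (s t : G) : leftRegular s (delta t) = delta (s * t) := by
  ext r
  rw [leftRegular_apply]
  rcases eq_or_ne r (s * t) with rfl | h
  · rw [inv_mul_cancel_left, delta_apply_self, delta_apply_self]
  · rw [delta_apply_ne h, delta_apply_ne (mt inv_mul_eq_iff_eq_mul.1 h)]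

theorem leftRegular_mem (s : G) : leftRegular s ∈ reducedCStarAlgebra G :=
  StarSubalgebra.le_topologicalClosure _ (StarAlgebra.subset_adjoin ℂ _ ⟨s, rfl⟩)

theorem mem_span_of_mem_adjoin {T : ell2 G →L[ℂ] ell2 G}
    (hT : T ∈ StarAlgebra.adjoin ℂ (range (leftRegular (G := G)))) :
    T ∈ Submodule.span ℂ (range (leftRegular (G := G))) := by
  let regularHom : G →* (ell2 G →L[ℂ] ell2 G) := ⟨⟨leftRegular, leftRegular_one⟩, leftRegular_mul⟩
  have hstar : star (range (leftRegular (G := G))) ⊆ range leftRegular := by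
    rintro T ⟨s, hs⟩
    exact ⟨s⁻¹, by rw [← star_leftRegular, hs, star_star]⟩
  have hmonoid : Submonoid.closure (range (leftRegular (G := G))) ≤ MonoidHom.mrange regularHom :=
    Submonoid.closure_le.2 subset_rfl
  rw [← StarSubalgebra.mem_toSubalgebra, StarAlgebra.adjoin_toSubalgebra, union_eq_left.2 hstar,
    ← Subalgebra.mem_toSubmodule, Algebra.adjoin_eq_span] at hT
  exact Submodule.span_mono hmonoid hT

/-- The canonical trace `T ↦ ⟨δ_e, T δ_e⟩`, as a functional on all bounded operators. -/
noncomputable def canonicalTrace : StrongDual ℂ (ell2 G →L[ℂ] ell2 G) :=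
  (innerSL ℂ (delta 1)).comp (ContinuousLinearMap.apply ℂ (ell2 G) (delta 1))

theorem canonicalTrace_apply (T : ell2 G →L[ℂ] ell2 G) :
    canonicalTrace T = inner ℂ (delta 1) (T (delta 1)) := rfl

theorem canonicalTrace_one : canonicalTrace (1 : ell2 G →L[ℂ] ell2 G) = 1 := by
  rw [canonicalTrace_apply, inner_delta, one_apply_eq_self, delta_apply_self]

theorem canonicalTrace_leftRegular {s : G} (hs : s ≠ 1) : canonicalTrace (leftRegular s) = 0 := by
  rw [canonicalTrace_apply, inner_delta, leftRegular_delta, mul_one, delta_apply_ne hs.symm]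

theorem canonicalTrace_star_mul_self_eq_zero_iff {T : ell2 G →L[ℂ] ell2 G} :
    canonicalTrace (star T * T) = 0 ↔ T (delta 1) = 0 := by
  rw [← inner_self_eq_zero (𝕜 := ℂ) (x := T (delta 1)), canonicalTrace_apply, mul_apply_eq_comp,
    ContinuousLinearMap.star_eq_adjoint, ContinuousLinearMap.adjoint_inner_right]

theorem eq_canonicalTrace_of_leftRegular {φ : StrongDual ℂ (ell2 G →L[ℂ] ell2 G)} (hone : φ 1 = 1)
    (h : ∀ s : G, s ≠ 1 → φ (leftRegular s) = 0) {T : ell2 G →L[ℂ] ell2 G}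
    (hT : T ∈ reducedCStarAlgebra G) : φ T = canonicalTrace T := by
  have hgenerators : EqOn φ canonicalTrace (range (leftRegular (G := G))) := by
    rintro _ ⟨s, rfl⟩
    rcases eq_or_ne s 1 with rfl | hs
    · rw [leftRegular_one, hone, canonicalTrace_one]
    · rw [h s hs, canonicalTrace_leftRegular hs]
  have hadjoin : EqOn φ canonicalTrace (StarAlgebra.adjoin ℂ (range (leftRegular (G := G)))) :=
    fun S hS => LinearMap.eqOn_span (f := φ.toLinearMap) (g := canonicalTrace.toLinearMap)
      hgenerators (mem_span_of_mem_adjoin hS)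
  exact hadjoin.closure φ.continuous canonicalTrace.continuous hT

theorem eq_bot_of_canonicalTrace_eq_zero {I : TwoSidedIdeal (reducedCStarAlgebra G)}
    (h : ∀ T ∈ I, canonicalTrace T.1 = 0) : I = ⊥ := by
  refine le_bot_iff.1 fun T hT => ?_
  refine (TwoSidedIdeal.mem_bot _).2 (Subtype.ext (eq_zero_of_apply_delta fun t => ?_))
  let S : reducedCStarAlgebra G := T * ⟨leftRegular t, leftRegular_mem t⟩
  have hS : S.1 (delta 1) = 0 := canonicalTrace_star_mul_self_eq_zero_iff.1
    (h (star S * S) (I.mul_mem_left _ _ (I.mul_mem_right _ _ hT)))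
  rwa [← mul_one t, ← leftRegular_delta]

end RegularRepresentation

section Multiplication

variable {G : Type u} {X : Type*} [Group G] [TopologicalSpace X] [MulAction G X]

theorem memlp_mul (x₀ : X) (f : X →ᵇ ℝ) (ξ : ell2 G) :
    Memℓp (fun t : G => (f (t • x₀) : ℂ) * ξ t) 2 := by
  refine Memℓp.mono ((lp.memℓp ξ).norm.const_mul ‖f‖) fun t => ?_
  rw [norm_mul, Complex.norm_real]
  exact mul_le_mul_of_nonneg_right (f.norm_coe_le_norm _) (norm_nonneg _)

theorem norm_mk_memlp_mul_le (x₀ : X) (f : X →ᵇ ℝ) (ξ : ell2 G) :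
    ‖(⟨fun t => (f (t • x₀) : ℂ) * ξ t, memlp_mul x₀ f ξ⟩ : ell2 G)‖ ≤ ‖f‖ * ‖ξ‖ := by
  rw [← norm_norm f, ← Complex.norm_real, ← norm_smul]
  refine lp.norm_mono two_ne_zero fun t => ?_
  rw [lp.coeFn_smul, Pi.smul_apply, norm_smul, Complex.norm_real, norm_norm]
  exact (norm_mul_le _ _).trans (by rw [Complex.norm_real]; gcongr; exact f.norm_coe_le_norm _)

/-- Multiplication by the restriction of a function on `X` to the orbit of `x₀`, as an operator on
`ℓ²(G)`. -/
noncomputable def mulOp (x₀ : X) : (X →ᵇ ℝ) →⋆ₐ[ℝ] (ell2 G →L[ℂ] ell2 G) where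
  toFun f := LinearMap.mkContinuous
    { toFun ξ := ⟨fun t => (f (t • x₀) : ℂ) * ξ t, memlp_mul x₀ f ξ⟩
      map_add' ξ η := by ext t; exact mul_add _ (ξ t) (η t)
      map_smul' c ξ := by ext t; exact mul_left_comm _ c (ξ t) } ‖f‖ (norm_mk_memlp_mul_le x₀ f)
  map_one' := by ext ξ t; exact one_mul (ξ t)
  map_zero' := by ext ξ t; exact zero_mul (ξ t)
  map_mul' f g := by ext ξ t; simp [mul_assoc]
  map_add' f g := by
    ext ξ t
    exact (congrArg (· * ξ t) (Complex.ofReal_add _ _)).trans (add_mul _ _ _)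
  commutes' r := by ext ξ t; simp
  map_star' f := by
    refine (ContinuousLinearMap.eq_adjoint_iff _ _).2 fun ξ η => ?_
    rw [lp.inner_eq_tsum, lp.inner_eq_tsum]
    exact tsum_congr fun t => by simp [mul_left_comm, mul_assoc]

theorem mulOp_apply (x₀ : X) (f : X →ᵇ ℝ) (ξ : ell2 G) (t : G) :
    mulOp x₀ f ξ t = (f (t • x₀) : ℂ) * ξ t := rfl

theorem norm_mulOp_le (x₀ : X) (f : X →ᵇ ℝ) : ‖mulOp (G := G) x₀ f‖ ≤ ‖f‖ :=
  LinearMap.mkContinuous_norm_le _ (norm_nonneg f) (norm_mk_memlp_mul_le x₀ f)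

theorem mulOp_mul_leftRegular [ContinuousConstSMul G X] (x₀ : X) (f : X →ᵇ ℝ) (s : G) :
    mulOp x₀ f * leftRegular s =
      leftRegular s * mulOp x₀ (f.compContinuous ⟨fun x => s • x, continuous_const_smul s⟩) := by
  ext ξ t
  simp [mul_apply_eq_comp, mulOp_apply, leftRegular_apply, smul_smul]

end Multiplication

/-! ### C*-simplicity -/

section AnnihilatingStates

theorem exists_strongDual_apply_eq_one {E : Type*} [SeminormedAddCommGroup E] [NormedSpace ℂ E]
    {J : Submodule ℂ E} {v : E} (hv : ‖v‖ ≤ 1) (h : ∀ x ∈ J, 1 ≤ ‖v - x‖) :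
    ∃ φ : StrongDual ℂ E, ‖φ‖ ≤ 1 ∧ φ v = 1 ∧ ∀ x ∈ J, φ x = 0 := by
  have hnorm : ‖J.mkQ v‖ = 1 := by
    refine le_antisymm ((Submodule.Quotient.norm_mk_le J v).trans hv)
      (QuotientAddGroup.le_norm_iff.2 fun w hw => ?_)
    simpa using h (v - w) ((Submodule.Quotient.eq J).1 hw.symm)
  obtain ⟨g, hg, hgv⟩ := exists_dual_vector'' ℂ (J.mkQ v)
  refine ⟨LinearMap.mkContinuous (g.toLinearMap ∘ₗ J.mkQ) 1 fun x => ?_,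
    LinearMap.mkContinuous_norm_le _ zero_le_one _,
    hgv.trans (by rw [hnorm, RCLike.ofReal_one]), fun x hx => ?_⟩
  · exact g.le_of_opNorm_le_of_le hg (Submodule.Quotient.norm_mk_le J x)
  · simp [(Submodule.Quotient.mk_eq_zero J).2 hx]

theorem one_le_norm_one_sub {R : Type*} [NormedRing R] [CompleteSpace R] {I : TwoSidedIdeal R}
    (hI : I ≠ ⊤) {x : R} (hx : x ∈ I) : 1 ≤ ‖1 - x‖ := by
  by_contra! hlt
  have htop : I.asIdeal = ⊤ :=
    Ideal.eq_top_of_norm_lt_one _ (TwoSidedIdeal.mem_asIdeal.2 hx) hlt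
  refine hI ((TwoSidedIdeal.one_mem_iff I).1 (TwoSidedIdeal.mem_asIdeal.1 ?_))
  exact htop ▸ Submodule.mem_top

variable {G : Type u} [Group G] {I : TwoSidedIdeal (reducedCStarAlgebra G)}

/-- The states of `B(ℓ²(G))` that vanish on an ideal of the reduced C*-algebra. A functional `φ` is
a state if and only if `‖φ‖ ≤ 1` and `φ 1 = 1`. -/
def annihilatingStates (I : TwoSidedIdeal (reducedCStarAlgebra G)) :
    Set (WeakDual ℂ (ell2 G →L[ℂ] ell2 G)) :=
  {φ | ‖WeakDual.toStrongDual φ‖ ≤ 1 ∧ φ 1 = 1 ∧ ∀ T ∈ I, φ T.1 = 0}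

theorem isCompact_annihilatingStates : IsCompact (annihilatingStates I) := by
  refine (WeakDual.isCompact_closedBall (𝕜 := ℂ) 0 1).of_isClosed_subset ?_ fun φ hφ =>
    mem_closedBall_zero_iff.2 hφ.1
  have hball : IsClosed {φ : WeakDual ℂ (ell2 G →L[ℂ] ell2 G) | ‖WeakDual.toStrongDual φ‖ ≤ 1} := by
    simpa [preimage, mem_closedBall_zero_iff] using
      WeakDual.isClosed_closedBall (𝕜 := ℂ) (0 : StrongDual ℂ (ell2 G →L[ℂ] ell2 G)) 1
  have hannihilator : IsClosed {φ : WeakDual ℂ (ell2 G →L[ℂ] ell2 G) | ∀ T ∈ I, φ T.1 = 0} := by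
    simp only [ofPred_forall]
    exact isClosed_biInter fun T _ => isClosed_eq (WeakDual.eval_continuous _) continuous_const
  exact hball.inter
    ((isClosed_eq (WeakDual.eval_continuous _) continuous_const).inter hannihilator)

theorem annihilatingStates_nonempty (hI : I ≠ ⊤) : (annihilatingStates I).Nonempty := by
  have : CompleteSpace (reducedCStarAlgebra G) :=
    (StarSubalgebra.isClosed_topologicalClosure _).completeSpace_coe
  let J : Submodule ℂ (ell2 G →L[ℂ] ell2 G) :=
    (I.asIdeal.restrictScalars ℂ).map (reducedCStarAlgebra G).subtype.toLinearMap
  obtain ⟨φ, hφ, hone, hJ⟩ := exists_strongDual_apply_eq_one (J := J) (v := 1)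
    ContinuousLinearMap.norm_id_le (by
      rintro _ ⟨T, hT, rfl⟩
      exact one_le_norm_one_sub hI (TwoSidedIdeal.mem_asIdeal.1 hT))
  exact ⟨StrongDual.toWeakDual φ, hφ, hone, fun T hT =>
    hJ _ ⟨T, TwoSidedIdeal.mem_asIdeal.2 hT, rfl⟩⟩

/-- The functional `T ↦ φ (λ_s⁻¹ T λ_s)`. -/
noncomputable def conjFunctional (s : G) (φ : WeakDual ℂ (ell2 G →L[ℂ] ell2 G)) :
    WeakDual ℂ (ell2 G →L[ℂ] ell2 G) :=
  StrongDual.toWeakDual ((WeakDual.toStrongDual φ).comp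
    (ContinuousLinearMap.mulLeftRight ℂ _ (leftRegular s⁻¹) (leftRegular s)))

theorem conjFunctional_apply (s : G) (φ : WeakDual ℂ (ell2 G →L[ℂ] ell2 G))
    (T : ell2 G →L[ℂ] ell2 G) :
    conjFunctional s φ T = φ (leftRegular s⁻¹ * T * leftRegular s) := rfl

theorem conjFunctional_mem_annihilatingStates (s : G) {φ : WeakDual ℂ (ell2 G →L[ℂ] ell2 G)}
    (hφ : φ ∈ annihilatingStates I) : conjFunctional s φ ∈ annihilatingStates I := by
  refine ⟨?_, ?_, fun T hT => ?_⟩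
  · have hconj : ‖ContinuousLinearMap.mulLeftRight ℂ (ell2 G →L[ℂ] ell2 G) (leftRegular s⁻¹)
        (leftRegular s)‖ ≤ 1 :=
      (ContinuousLinearMap.opNorm_mulLeftRight_apply_apply_le ℂ _ _ _).trans
        (mul_le_one₀ (norm_leftRegular_le _) (norm_nonneg _) (norm_leftRegular_le _))
    exact (ContinuousLinearMap.opNorm_comp_le _ _).trans
      (mul_le_one₀ hφ.1 (norm_nonneg _) hconj)
  · rw [conjFunctional_apply, mul_one, ← leftRegular_mul, inv_mul_cancel, leftRegular_one, hφ.2.1]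
  · exact hφ.2.2 (⟨_, leftRegular_mem s⁻¹⟩ * T * ⟨_, leftRegular_mem s⟩)
      (I.mul_mem_right _ _ (I.mul_mem_left _ _ hT))

end AnnihilatingStates

section Restriction

theorem mem_stateSpace_of_le_norm {X : Type*} [TopologicalSpace X] {φ : Functional X}
    (hone : φ 1 = 1) (h : ∀ f, φ f ≤ ‖f‖) : φ ∈ stateSpace X := by
  refine ⟨hone, fun f hf => ?_⟩
  have hnorm : ‖‖f‖ • (1 : X →ᵇ ℝ) - f‖ ≤ ‖f‖ := by
    refine (BoundedContinuousFunction.norm_le (norm_nonneg f)).2 fun x => ?_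
    have hx := (le_abs_self _).trans (f.norm_coe_le_norm x)
    rw [Real.norm_of_nonneg (by simpa using hx)]
    simpa using hf x
  have hle := (h _).trans hnorm
  rw [map_sub, map_smul, hone, smul_eq_mul, mul_one] at hle
  linarith

variable {G : Type u} {X : Type*} [Group G] [TopologicalSpace X] [MulAction G X] {x₀ : X}
  {φ : WeakDual ℂ (ell2 G →L[ℂ] ell2 G)}

/-- The functional `f ↦ Re φ(M_f)`, where `M_f` is the multiplication by `f` along the orbit of
`x₀`. -/
noncomputable def restrictFunctional (x₀ : X) (φ : WeakDual ℂ (ell2 G →L[ℂ] ell2 G)) :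
    Functional X :=
  StrongDual.toWeakDual <| LinearMap.mkContinuous
    { toFun f := (φ (mulOp x₀ f)).re
      map_add' f g := by rw [map_add, map_add, Complex.add_re]
      map_smul' c f := by
        rw [map_smul, show c • mulOp x₀ f = (c : ℂ) • mulOp x₀ f from rfl, map_smul, smul_eq_mul,
          Complex.re_ofReal_mul, RingHom.id_apply, smul_eq_mul] }
    ‖WeakDual.toStrongDual φ‖ fun f => (Complex.abs_re_le_norm _).trans
      ((WeakDual.toStrongDual φ).le_opNorm_of_le (norm_mulOp_le x₀ f))

theorem restrictFunctional_apply (f : X →ᵇ ℝ) :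
    restrictFunctional x₀ φ f = (φ (mulOp x₀ f)).re := rfl

variable (x₀) in
theorem continuous_restrictFunctional : Continuous (restrictFunctional (G := G) x₀) :=
  Functional.continuous_of_eval fun f =>
    Complex.continuous_re.comp (WeakDual.eval_continuous (mulOp x₀ f))

theorem restrictFunctional_mem_stateSpace (hφ : ‖WeakDual.toStrongDual φ‖ ≤ 1) (hone : φ 1 = 1) :
    restrictFunctional x₀ φ ∈ stateSpace X := by
  refine mem_stateSpace_of_le_norm ?_ fun f => ?_
  · rw [restrictFunctional_apply, map_one, hone, Complex.one_re]
  · calc (φ (mulOp x₀ f)).re ≤ ‖φ (mulOp x₀ f)‖ := Complex.re_le_norm _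
      _ ≤ 1 * ‖f‖ :=
        (WeakDual.toStrongDual φ).le_of_opNorm_le_of_le hφ (norm_mulOp_le x₀ f)
      _ = ‖f‖ := one_mul _

variable [ContinuousConstSMul G X]

theorem restrictFunctional_conjFunctional (s : G) :
    restrictFunctional x₀ (conjFunctional s φ) = s • restrictFunctional x₀ φ :=
  Functional.ext fun f => by
    rw [restrictFunctional_apply, conjFunctional_apply, mul_assoc, mulOp_mul_leftRegular,
      ← mul_assoc, ← leftRegular_mul, inv_mul_cancel, leftRegular_one, one_mul,
      Functional.group_smul_apply, restrictFunctional_apply]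

/-- If `f y = 1` and `f (s • y) = 0`, then `φ (λ_s) = φ (M_f λ_s) = φ (λ_s M_{f ∘ s}) = 0`, since
`φ` is multiplicative along the multiplication operators. -/
theorem apply_leftRegular_eq_zero [CompactSpace X] [T2Space X] (hφ : ‖WeakDual.toStrongDual φ‖ ≤ 1)
    {y : X} (hy : restrictFunctional x₀ φ = pointState y) {s : G} (hs : s • y ≠ y) :
    φ (leftRegular s) = 0 := by
  have hmul := apply_mul_of_re_apply_eq (π := mulOp x₀) hφ fun f => DFunLike.congr_fun hy f
  obtain ⟨f, hf₀, hf₁, -⟩ := exists_continuous_zero_one_of_isClosed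
    (isClosed_singleton (x := s • y)) (isClosed_singleton (x := y)) (by simpa using hs)
  let F : X →ᵇ ℝ := BoundedContinuousFunction.mkOfCompact f
  have hFy : F y = 1 := hf₁ rfl
  have hFsy : F (s • y) = 0 := hf₀ rfl
  calc φ (leftRegular s) = F y * φ (leftRegular s) := by rw [hFy, Complex.ofReal_one, one_mul]
    _ = φ (mulOp x₀ F * leftRegular s) := (hmul F _).1.symm
    _ = φ (leftRegular s * mulOp x₀ (F.compContinuous ⟨fun x => s • x, _⟩)) := by
      rw [mulOp_mul_leftRegular]
    _ = F (s • y) * φ (leftRegular s) := (hmul _ _).2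
    _ = 0 := by rw [hFsy, Complex.ofReal_zero, zero_mul]

end Restriction

section Simple

theorem IsStateProximal.pointState_mem_closure {G X : Type*} [Group G] [TopologicalSpace X]
    [MulAction G X] [ContinuousConstSMul G X] [MulAction.IsMinimal G X] (hX : IsStateProximal G X)
    {φ : Functional X} (hφ : φ ∈ stateSpace X) (y : X) :
    pointState y ∈ closure (MulAction.orbit G φ) := by
  obtain ⟨x, hx⟩ := hX φ hφ
  have hclosed : IsClosed {z : X | pointState z ∈ closure (MulAction.orbit G φ)} :=
    isClosed_closure.preimage continuous_pointState
  have horbit : MulAction.orbit G x ⊆ {z | pointState z ∈ closure (MulAction.orbit G φ)} := by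
    rintro _ ⟨s, rfl⟩
    rw [mem_ofPred_eq, ← smul_pointState]
    exact map_mem_closure (continuous_const_smul s) hx (MulAction.mapsTo_smul_orbit s φ)
  exact closure_minimal horbit hclosed (MulAction.dense_orbit G x y)

variable {G : Type u} {X : Type*} [Group G] [TopologicalSpace X] [MulAction G X]
  [ContinuousConstSMul G X]

theorem IsStateProximal.exists_restrictFunctional_eq_pointState [MulAction.IsMinimal G X]
    (hX : IsStateProximal G X) {I : TwoSidedIdeal (reducedCStarAlgebra G)} (hI : I ≠ ⊤) (x₀ y : X) :
    ∃ φ ∈ annihilatingStates I, restrictFunctional x₀ φ = pointState y := by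
  obtain ⟨φ, hφ⟩ := annihilatingStates_nonempty hI
  have horbit : MulAction.orbit G (restrictFunctional x₀ φ) ⊆
      restrictFunctional x₀ '' annihilatingStates I := by
    rintro _ ⟨s, rfl⟩
    exact ⟨_, conjFunctional_mem_annihilatingStates s hφ, restrictFunctional_conjFunctional s⟩
  exact closure_minimal horbit
    (isCompact_annihilatingStates.image (continuous_restrictFunctional x₀)).isClosed
    (hX.pointState_mem_closure (restrictFunctional_mem_stateSpace hφ.1 hφ.2.1) y)

theorem isCStarSimple_of_free_point [CompactSpace X] [T2Space X] [MulAction.IsMinimal G X]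
    (hX : IsStateProximal G X) {y : X} (hy : ∀ s : G, s ≠ 1 → s • y ≠ y) : IsCStarSimple G := by
  refine fun I _ => or_iff_not_imp_right.2 fun hI => eq_bot_of_canonicalTrace_eq_zero fun T hT => ?_
  obtain ⟨φ, ⟨hφ, hone, hφI⟩, hφy⟩ := hX.exists_restrictFunctional_eq_pointState hI y y
  rw [← eq_canonicalTrace_of_leftRegular (φ := WeakDual.toStrongDual φ) hone
    (fun s hs => apply_leftRegular_eq_zero hφ hφy (hy s hs)) T.2]
  exact hφI T hT

theorem IsTopologicallyFree.exists_free_point {X : Type u} [TopologicalSpace X] [MulAction G X]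
    [ContinuousConstSMul G X] [Countable G] [CompactSpace X] [T2Space X] [Nonempty X]
    (hX : IsTopologicallyFree G X) : ∃ y : X, ∀ s : G, s ≠ 1 → s • y ≠ y := by
  have hdense : Dense (⋂ s : {s : G // s ≠ 1}, {x : X | s.1 • x ≠ x}) :=
    dense_iInter_of_isOpen (fun s => isOpen_ne_fun (continuous_const_smul s.1) continuous_id)
      fun s => hX s.1 s.2
  obtain ⟨y, hy⟩ := hdense.nonempty
  exact ⟨y, fun s hs => mem_iInter.1 hy ⟨s, hs⟩⟩

theorem countable_of_fg (hG : Group.FG G) : Countable G := by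
  obtain ⟨S, hS, π, hπ⟩ := Group.fg_iff_exists_freeGroup_hom_surjective.1 hG
  have := hS.countable.to_subtype
  exact hπ.countable

end Simple

end Tarski

theorem mainTheorem6 {G : Type u} [Group G] (p : ℕ)
    (hG : Tarski.IsTarskiMonster G p) (hna : ¬ Tarski.IsAmenable G) :
    (∃ (X : Type u) (_ : TopologicalSpace X) (_ : MulAction G X) (_ : ContinuousConstSMul G X),
      Tarski.IsFurstenbergBoundary G X) ∧
    (∀ (X : Type u) [TopologicalSpace X] [MulAction G X] [ContinuousConstSMul G X],
      Tarski.IsFurstenbergBoundary G X → Tarski.IsTopologicallyFree G X) ∧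
    Tarski.IsCStarSimple G := by
  have hfree : ∀ (X : Type u) [TopologicalSpace X] [MulAction G X] [ContinuousConstSMul G X],
      Tarski.IsFurstenbergBoundary G X → Tarski.IsTopologicallyFree G X := by
    intro X _ _ _ hX
    have := hX.isBoundary.compact
    have := hX.isBoundary.minimal
    exact hG.isTopologicallyFree fun x => hX.exists_smul_ne hna x
  refine ⟨Tarski.exists_isFurstenbergBoundary G, hfree, ?_⟩
  obtain ⟨X, _, _, _, hX⟩ := Tarski.exists_isFurstenbergBoundary G
  have := hX.isBoundary.compact
  have := hX.isBoundary.hausdorff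
  have := hX.isBoundary.nonempty
  have := hX.isBoundary.minimal
  have := Tarski.countable_of_fg hG.fg
  obtain ⟨y, hy⟩ := (hfree X hX).exists_free_point
  exact Tarski.isCStarSimple_of_free_point
    (Tarski.isStronglyProximal_iff.1 hX.isBoundary.stronglyProximal) hy
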